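/- Let $\Omega=\{(a,b)\in\mathbb{R}^2 : a,b\in(0,1],\ a+b>1\}$, let $k(a,b)=\left\lfloor\frac{1+a}{b}\right\rfloor$ for $(a,b)\in\Omega$, and let $T:\Omega\to\Omega$, $T(a,b)=\left(b,\,-a+k(a,b)\,b\right)$, be the BCZ map, which is a bijection. For $n\in\mathbb{Z}$ put $k_n(a,b)=k\left(T^{n-1}(a,b)\right)$. For an irrational number $s$ define its even and odd Diophantine exponents, with values in $[2,\infty]$, by $$e^+(s)=\sup\left\{v\in\mathbb{R} : 0<\tfrac pq-s<\tfrac1{q^v}\text{ for infinitely many rationals }\tfrac pq\right\},$$ $$e^-(s)=\sup\left\{v\in\mathbb{R} : 0<s-\tfrac pq<\tfrac1{q^v}\text{ for infinitely many rationals }\tfrac pq\right\},$$ where $\frac pq$ is in lowest terms with $q>0$. **Theorem 1.3.** Let $(a,b)\in\Omega$ with $\frac ba$ irrational, let $e^{\pm}=e^{\pm}\left(\frac ba\right)$, and let $f_{-n}=\sum_{i=0}^{n}\left(k_{-i}(a,b)-3\right)$ for $n\ge1$. Then $$\limsup_{n\to+\infty}\frac{\log|f_{-n}|}{\log n}=\max\left\{\frac{e^+-1}{e^+},\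 \frac{e^--2}{e^-}\right\},$$ where $\frac{e-1}{e}$ and $\frac{e-2}{e}$ are read as $1$ if $e=\infty$. -/

import Mathlib

noncomputable section

/-- The Farey (BCZ) triangle `Ω = {(a, b) | a, b ∈ (0, 1], a + b > 1}`. -/
def fareyTriangle : Set (ℝ × ℝ) :=
  {x | (0 < x.1 ∧ x.1 ≤ 1) ∧ (0 < x.2 ∧ x.2 ≤ 1) ∧ 1 < x.1 + x.2}

/-- The itinerary (index) function `k(a, b) = ⌊(1 + a) / b⌋`. -/
def bczIndex (x : ℝ × ℝ) : ℤ := ⌊(1 + x.1) / x.2⌋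

/-- The BCZ map `T(a, b) = (b, -a + ⌊(1 + a) / b⌋ b)`. -/
def bczMap (x : ℝ × ℝ) : ℝ × ℝ := (x.2, -x.1 + (bczIndex x : ℝ) * x.2)

/-- `T` maps the Farey triangle to itself. -/
theorem bczMap_mem {x : ℝ × ℝ} (hx : x ∈ fareyTriangle) : bczMap x ∈ fareyTriangle := by
  obtain ⟨⟨h1, h2⟩, ⟨h3, h4⟩, h5⟩ := hx
  have hl : (bczIndex x : ℝ) * x.2 ≤ 1 + x.1 :=
    (le_div_iff₀ h3).1 (Int.floor_le ((1 + x.1) / x.2))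
  have hu : 1 + x.1 < ((bczIndex x : ℝ) + 1) * x.2 :=
    (div_lt_iff₀ h3).1 (Int.lt_floor_add_one ((1 + x.1) / x.2))
  refine ⟨⟨h3, h4⟩, ⟨?_, ?_⟩, ?_⟩ <;> simp only [bczMap] <;> linarith

/-- The triangle is symmetric in the two coordinates. -/
theorem swap_mem_fareyTriangle {x : ℝ × ℝ} (hx : x ∈ fareyTriangle) :
    x.swap ∈ fareyTriangle := by
  obtain ⟨h1, h2, h3⟩ := hx
  exact ⟨h2, h1, by simpa [add_comm] using h3⟩

/-- `T` conjugated by the coordinate swap is inverse to `T` on the triangle. -/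
theorem swap_bczMap_swap_bczMap {x : ℝ × ℝ} (hx : x ∈ fareyTriangle) :
    (bczMap (bczMap x).swap).swap = x := by
  obtain ⟨⟨h1, h2⟩, ⟨h3, h4⟩, h5⟩ := hx
  have key : bczIndex (bczMap x).swap = bczIndex x := by
    have h : (1 + (bczMap x).swap.1) / (bczMap x).swap.2
        = (1 - x.1) / x.2 + (bczIndex x : ℝ) := by
      simp only [bczMap, Prod.fst_swap, Prod.snd_swap]
      field_simp
      ring
    have h0 : ⌊(1 - x.1) / x.2⌋ = 0 := by
      rw [Int.floor_eq_zero_iff]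
      exact ⟨div_nonneg (by linarith) h3.le, by rw [div_lt_one h3]; linarith⟩
    have h' : bczIndex (bczMap x).swap = ⌊(1 - x.1) / x.2 + (bczIndex x : ℝ)⌋ := by
      rw [← h, bczIndex]
    rw [h', Int.floor_add_intCast, h0, zero_add]
  have h6 : bczMap (bczMap x).swap
      = ((bczMap x).swap.2, -(bczMap x).swap.1 + (bczIndex x : ℝ) * (bczMap x).swap.2) := by
    rw [← key, bczMap]
  rw [h6]
  ext <;> simp [bczMap]

/-- The BCZ map as a bijection of the Farey triangle, so that `bczPerm ^ n` makes sense for all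
`n : ℤ`. -/
def bczPerm : Equiv.Perm fareyTriangle where
  toFun x := ⟨bczMap x, bczMap_mem x.2⟩
  invFun x := ⟨(bczMap (x : ℝ × ℝ).swap).swap,
    swap_mem_fareyTriangle (bczMap_mem (swap_mem_fareyTriangle x.2))⟩
  left_inv x := Subtype.ext (swap_bczMap_swap_bczMap x.2)
  right_inv x := by
    have h := swap_bczMap_swap_bczMap (swap_mem_fareyTriangle x.2)
    apply Subtype.ext
    simpa using congrArg Prod.swap h

/-- The itinerary `k_n(a, b) = k(T^(n-1)(a, b))`, `n ∈ ℤ`. -/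
def itinerary (x : fareyTriangle) (n : ℤ) : ℤ := bczIndex ((bczPerm ^ (n - 1)) x : fareyTriangle)

/-- `f_{-n} = ∑_{i=0}^n (k_{-i}(a, b) - 3)`. -/
def backwardSum (x : fareyTriangle) (n : ℕ) : ℤ :=
  ∑ i ∈ Finset.range (n + 1), (itinerary x (-(i : ℤ)) - 3)

/-- The even Diophantine exponent `e⁺(s)`, with values in the extended reals: the supremum of the
real `v` such that `0 < p/q - s < 1/q^v` for infinitely many rationals `p/q` (in lowest terms,
`q > 0`). -/
def evenDiophantineExponent (s : ℝ) : EReal :=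
  sSup ((fun v : ℝ => (v : EReal)) ''
    {v : ℝ | {r : ℚ | 0 < (r : ℝ) - s ∧ (r : ℝ) - s < 1 / (r.den : ℝ) ^ v}.Infinite})

/-- The odd Diophantine exponent `e⁻(s)`: the same with `0 < s - p/q < 1/q^v`. -/
def oddDiophantineExponent (s : ℝ) : EReal :=
  sSup ((fun v : ℝ => (v : EReal)) ''
    {v : ℝ | {r : ℚ | 0 < s - (r : ℝ) ∧ s - (r : ℝ) < 1 / (r.den : ℝ) ^ v}.Infinite})

open Classical in
/-- The quotient `(e - c) / e`, read as its limit `1` when `e = ∞`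
(the arithmetic of `EReal` would give `⊤ / ⊤ = 0` there). -/
def exponentRatio (c : ℝ) (e : EReal) : EReal := if e = ⊤ then 1 else (e - (c : EReal)) / e

end

/-! The first coordinates of the backward orbit are the abscissae `x = p * a - q * b` of integer
vectors `(p, q)`. Consecutive vectors have determinant one, and since consecutive abscissae sum to
more than `1`, the chain lists all primitive vectors with `q ≥ 0` and `0 < x ≤ 1` by increasing
slope `q / x`. The slope at index `n` is of order `n` (`mul_le_slope`, `slope_le`). By
`sternBrocotWeight_step` the partial sums of `k - 3` are, up to a constant, Stern–Brocot weights of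
consecutive pairs, so they can be compared with any other chain for `b / a`.

Upper bound (`abs_sum_le_slope_rpow`): each consecutive pair lies in a cone of the minus continued
fraction chain `(P i, Q i)` with decreasing abscissae `X i`. Its weight differs from that of the
cone by at most the sum of the cone coordinates, which are bounded by `1 / X i` and `S / Q (i + 1)`,
with `S` the slope of the second vector of the pair. The weight of the cone is itself bounded by
about `1 / X i + i`. Approximation from above controls the terms `1 / X i` and `S / Q (i + 1)`;
approximation from below controls the number of steps `i`. All are `O(S ^ ρ)`.

Lower bound: an upper approximant of small abscissa `x` causes one jump of size about `2 / x`
(`exists_large_sum_of_upper`). A lower approximant `(r, s)` at distance `ξ` makes the weights drift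
by `-1` along a progression of about `1 / (ξ * s)` chain vectors (`exists_large_sum_of_lower`).
Comparing these sizes with the indices, at most of order `s / x` and `s / ξ`, gives the two ratios
`(e - 1) / e` and `(e - 2) / e`. -/

/-! ### Stern–Brocot weights of unimodular pairs -/

/-- The signed length of the Stern–Brocot path to the Farey interval with right endpoint `p / q` and
left endpoint `p' / q'`: steps towards the left endpoint count `-1`, the others `+1`. -/
def sternBrocotWeight (p q p' q' : ℤ) : ℤ :=
  if 0 ≤ p' ∧ 0 ≤ q' ∧ 0 < p' + q' ∧ p' ≤ p ∧ q' ≤ q then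
    sternBrocotWeight (p - p') (q - q') p' q' - 1
  else if 0 ≤ p ∧ 0 ≤ q ∧ 0 < p + q ∧ p ≤ p' ∧ q ≤ q' then
    sternBrocotWeight p q (p' - p) (q' - q) + 1
  else 0
termination_by (p + q + p' + q').toNat
decreasing_by all_goals omega

theorem sternBrocotWeight_add_left {p q p' q' : ℤ} (hp : 0 ≤ p) (hq : 0 ≤ q) (hp' : 0 ≤ p')
    (hq' : 0 ≤ q') (h' : 0 < p' + q') :
    sternBrocotWeight (p + p') (q + q') p' q' = sternBrocotWeight p q p' q' - 1 := by
  rw [sternBrocotWeight, if_pos ⟨hp', hq', h', by omega, by omega⟩]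
  simp

theorem sternBrocotWeight_add_right {p q p' q' : ℤ} (hp : 0 ≤ p) (hq : 0 ≤ q) (hp' : 0 ≤ p')
    (hq' : 0 ≤ q') (h : 0 < p + q) (h' : 0 < p' + q') :
    sternBrocotWeight p q (p + p') (q + q') = sternBrocotWeight p q p' q' + 1 := by
  rw [sternBrocotWeight, if_neg (by omega), if_pos ⟨hp, hq, h, by omega, by omega⟩]
  simp

theorem sternBrocotWeight_add_mul_left {p q p' q' : ℤ} (hp : 0 ≤ p) (hq : 0 ≤ q) (hp' : 0 ≤ p')
    (hq' : 0 ≤ q') (h' : 0 < p' + q') (j : ℕ) :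
    sternBrocotWeight (p + j * p') (q + j * q') p' q' = sternBrocotWeight p q p' q' - j := by
  induction j with
  | zero => simp
  | succ j ih =>
    have := sternBrocotWeight_add_left (p := p + j * p') (q := q + j * q') (by positivity)
      (by positivity) hp' hq' h'
    push_cast
    rw [show p + (j + 1) * p' = p + j * p' + p' by ring,
      show q + (j + 1) * q' = q + j * q' + q' by ring, this, ih]
    ring

theorem sternBrocotWeight_add_mul_right {p q p' q' : ℤ} (hp : 0 ≤ p) (hq : 0 ≤ q) (hp' : 0 ≤ p')
    (hq' : 0 ≤ q') (h : 0 < p + q) (h' : 0 < p' + q') (j : ℕ) :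
    sternBrocotWeight p q (p' + j * p) (q' + j * q) = sternBrocotWeight p q p' q' + j := by
  induction j with
  | zero => simp
  | succ j ih =>
    have hjp : 0 ≤ j * p := by positivity
    have hjq : 0 ≤ j * q := by positivity
    have := sternBrocotWeight_add_right (p' := p' + j * p) (q' := q' + j * q) hp hq (by positivity)
      (by positivity) h (by omega)
    push_cast
    rw [show p' + (j + 1) * p = p + (p' + j * p) by ring,
      show q' + (j + 1) * q = q + (q' + j * q) by ring, this, ih]
    ring

/-- Of two nonnegative integer vectors of determinant one, one dominates the other, unless they form
the standard basis. -/
theorem dominates_of_det_eq_one {p q p' q' : ℤ} (hp : 0 ≤ p) (hq : 0 ≤ q) (hp' : 0 ≤ p')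
    (hq' : 0 ≤ q') (hdet : p * q' - p' * q = 1) :
    (p' ≤ p ∧ q' ≤ q) ∨ (p ≤ p' ∧ q ≤ q') ∨ (p = 1 ∧ q = 0 ∧ p' = 0 ∧ q' = 1) := by
  by_contra! hcon
  obtain ⟨h1, h2, h3⟩ := hcon
  rcases lt_or_ge p p' with h | h
  · have := h2 h.le
    nlinarith
  · have h4 := h1 h
    have h5 : p' < p := by
      by_contra h6
      have := h2 (by omega)
      omega
    have h6 : p' = 0 := by nlinarith
    have h7 : q = 0 := by nlinarith
    subst h6 h7
    have h8 : p * q' = 1 := by linarith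
    have h9 : p = 1 := Int.eq_one_of_mul_eq_one_right hp h8
    subst h9
    exact h3 rfl rfl rfl (by linarith)

theorem pos_add_of_det_eq_one {p q p' q' : ℤ} (hp : 0 ≤ p) (hq : 0 ≤ q) (hp' : 0 ≤ p')
    (hq' : 0 ≤ q') (hdet : p * q' - p' * q = 1) : 0 < p + q ∧ 0 < p' + q' := by
  constructor
  · by_contra h
    obtain rfl : p = 0 := by omega
    obtain rfl : q = 0 := by omega
    simp at hdet
  · by_contra h
    obtain rfl : p' = 0 := by omega
    obtain rfl : q' = 0 := by omega
    simp at hdet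

/-- Write `u, w, t` for the three vectors, `u + t = k w`. Subtracting `w` from `u` or from `t`, when
possible, lowers `k` by one and changes one weight by one, so the identity descends. When neither is
possible, `w = u + t` and `k = 1`, and the two weights are one below and one above that of `(u, t)`.
-/
theorem sternBrocotWeight_step (N : ℕ) : ∀ {p q p' q' p'' q'' k : ℤ}, 0 ≤ p → 0 ≤ q → 0 ≤ p' →
    0 ≤ q' → 0 ≤ p'' → 0 ≤ q'' → p * q' - p' * q = 1 → p + p'' = k * p' → q + q'' = k * q' →
    p + q + p'' + q'' ≤ N →
    sternBrocotWeight p' q' p'' q'' = sternBrocotWeight p q p' q' + k - 3 := by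
  induction N with
  | zero =>
    intro p q p' q' p'' q'' k hp hq hp' hq' hp'' hq'' hdet h1 h2 hN
    have := (pos_add_of_det_eq_one hp hq hp' hq' hdet).1
    omega
  | succ N ih =>
    intro p q p' q' p'' q'' k hp hq hp' hq' hp'' hq'' hdet h1 h2 hN
    have hdet' : p' * q'' - p'' * q' = 1 := by
      have e1 : p'' = k * p' - p := by linarith
      have e2 : q'' = k * q' - q := by linarith
      rw [e1, e2]; linarith
    obtain ⟨hu, hw⟩ := pos_add_of_det_eq_one hp hq hp' hq' hdet
    obtain ⟨-, ht⟩ := pos_add_of_det_eq_one hp' hq' hp'' hq'' hdet'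
    by_cases hA : p' ≤ p ∧ q' ≤ q
    · have e := sternBrocotWeight_add_left (p := p - p') (q := q - q') (by omega) (by omega)
        hp' hq' hw
      rw [sub_add_cancel, sub_add_cancel] at e
      have := ih (p := p - p') (q := q - q') (p' := p') (q' := q') (p'' := p'') (q'' := q'')
        (k := k - 1) (by omega) (by omega) hp' hq' hp'' hq'' (by linarith) (by linarith)
        (by linarith) (by push_cast at hN; omega)
      rw [this, e]; ring
    by_cases hB : p' ≤ p'' ∧ q' ≤ q''
    · have hne : 0 < (p'' - p') + (q'' - q') := by
        by_contra h
        obtain rfl : p'' = p' := by omega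
        obtain rfl : q'' = q' := by omega
        linarith [mul_comm p'' q'']
      have e := sternBrocotWeight_add_right (p' := p'' - p') (q' := q'' - q') hp' hq'
        (by omega) (by omega) hw hne
      rw [add_sub_cancel, add_sub_cancel] at e
      have := ih (p := p) (q := q) (p' := p') (q' := q') (p'' := p'' - p') (q'' := q'' - q')
        (k := k - 1) hp hq hp' hq' (by omega) (by omega) hdet (by linarith)
        (by linarith) (by push_cast at hN; omega)
      rw [e, this]; ring
    · rcases dominates_of_det_eq_one hp hq hp' hq' hdet with h | h | ⟨rfl, rfl, rfl, rfl⟩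
      · exact absurd h hA
      · rcases dominates_of_det_eq_one hp' hq' hp'' hq'' hdet' with h' | h' | ⟨rfl, rfl, rfl, rfl⟩
        -- If `k ≥ 2`, then `t ≤ w` gives `u = k w - t ≥ w`, against `hA`.
        · have hk : k = 1 := by
            have hk0 : 0 < k := by
              by_contra hk
              nlinarith
            by_contra hk1
            have hk2 : 2 ≤ k := by omega
            have : p' ≤ p ∧ q' ≤ q := by constructor <;> nlinarith
            exact hA this
          subst hk
          obtain rfl : p' = p + p'' := by linarith
          obtain rfl : q' = q + q'' := by linarith
          rw [sternBrocotWeight_add_left hp hq hp'' hq'' ht,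
            sternBrocotWeight_add_right hp hq hp'' hq'' hu ht]
          ring
        · exact absurd h' hB
        · omega
      · omega

/-- Euclidean descent on the coordinates: each subtraction of one coordinate vector from the other
changes the weight by one and lowers `α + β + γ + δ` by at least one, until the standard basis, with
sum `2`, is reached. -/
theorem abs_sternBrocotWeight_cone_sub_le {p q p' q' : ℤ} (hp : 0 ≤ p) (hq : 0 ≤ q) (hp' : 0 ≤ p')
    (hq' : 0 ≤ q') (hu : 0 < p + q) (hw : 0 < p' + q') (N : ℕ) :
    ∀ {α β γ δ : ℤ}, 0 ≤ α → 0 ≤ β → 0 ≤ γ → 0 ≤ δ → α * δ - γ * β = 1 → α + β + γ + δ ≤ N →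
    |sternBrocotWeight (α * p + β * p') (α * q + β * q') (γ * p + δ * p') (γ * q + δ * q') -
      sternBrocotWeight p q p' q'| ≤ α + β + γ + δ - 2 := by
  induction N with
  | zero =>
    intro α β γ δ h1 h2 h3 h4 hdet hN
    have := (pos_add_of_det_eq_one h1 h2 h3 h4 hdet).1
    omega
  | succ N ih =>
    intro α β γ δ h1 h2 h3 h4 hdet hN
    have key : ∀ {x y : ℤ}, 0 ≤ x → 0 ≤ y → 0 < x + y →
        0 ≤ x * p + y * p' ∧ 0 ≤ x * q + y * q' ∧ 0 < x * p + y * p' + (x * q + y * q') := by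
      intro x y hx hy hxy
      refine ⟨by positivity, by positivity, ?_⟩
      rcases hx.lt_or_eq with hx | rfl
      · nlinarith [mul_nonneg hy hw.le, mul_pos hx hu]
      · have : 0 < y := by omega
        nlinarith [mul_pos this hw]
    obtain ⟨hs, ht⟩ := pos_add_of_det_eq_one h1 h2 h3 h4 hdet
    obtain ⟨k1, k2, k3⟩ := key h1 h2 hs
    obtain ⟨k4, k5, k6⟩ := key h3 h4 ht
    rcases dominates_of_det_eq_one h1 h2 h3 h4 hdet with h | h | ⟨rfl, rfl, rfl, rfl⟩
    · have i := ih (α := α - γ) (β := β - δ) (by omega) (by omega) h3 h4 (by linarith)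
        (by push_cast at hN; omega)
      have e := sternBrocotWeight_add_left (p := (α - γ) * p + (β - δ) * p')
        (q := (α - γ) * q + (β - δ) * q') (p' := γ * p + δ * p') (q' := γ * q + δ * q')
        (add_nonneg (mul_nonneg (by omega) hp) (mul_nonneg (by omega) hp'))
        (add_nonneg (mul_nonneg (by omega) hq) (mul_nonneg (by omega) hq')) k4 k5 k6
      rw [show (α - γ) * p + (β - δ) * p' + (γ * p + δ * p') = α * p + β * p' by ring,
        show (α - γ) * q + (β - δ) * q' + (γ * q + δ * q') = α * q + β * q' by ring] at e
      rw [e]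
      rw [abs_le] at i ⊢
      omega
    · have i := ih (γ := γ - α) (δ := δ - β) h1 h2 (by omega) (by omega) (by linarith)
        (by push_cast at hN; omega)
      have hne : 0 < (γ - α) + (δ - β) := by
        by_contra hh
        obtain rfl : γ = α := by omega
        obtain rfl : δ = β := by omega
        simp at hdet
      obtain ⟨k7, k8, k9⟩ := key (x := γ - α) (y := δ - β) (by omega) (by omega) hne
      have e := sternBrocotWeight_add_right k1 k2 k7 k8 k3 k9
      rw [show α * p + β * p' + ((γ - α) * p + (δ - β) * p') = γ * p + δ * p' by ring,
        show α * q + β * q' + ((γ - α) * q + (δ - β) * q') = γ * q + δ * q' by ring] at e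
      rw [e]
      rw [abs_le] at i ⊢
      omega
    · simp

/-! ### Chains of lattice vectors in the strip -/

/-- The abscissa `p a - q b` of the lattice vector with integer coordinates `(p, q)`. -/
def latticeAbscissa (a b : ℝ) (p q : ℤ) : ℝ := p * a - q * b

/-- A chain of integer vectors starting at `(1, 0)` and turned by the coefficients `K`, with
abscissae in `(0, 1]`. -/
structure IsFareyChain (a b : ℝ) (K p q : ℕ → ℤ) : Prop where
  p_zero : p 0 = 1
  q_zero : q 0 = 0
  p_one : p 1 = K 0
  q_one : q 1 = 1
  p_add_two : ∀ n, p (n + 2) = K (n + 1) * p (n + 1) - p n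
  q_add_two : ∀ n, q (n + 2) = K (n + 1) * q (n + 1) - q n
  pos : ∀ n, 0 < latticeAbscissa a b (p n) (q n)
  le_one : ∀ n, latticeAbscissa a b (p n) (q n) ≤ 1

namespace IsFareyChain

variable {a b : ℝ} {K p q : ℕ → ℤ}

theorem det (h : IsFareyChain a b K p q) (n : ℕ) : p n * q (n + 1) - p (n + 1) * q n = 1 := by
  induction n with
  | zero => simp [h.p_zero, h.q_zero, h.q_one]
  | succ n ih => rw [h.p_add_two, h.q_add_two]; linarith

theorem abscissa_zero (h : IsFareyChain a b K p q) : latticeAbscissa a b (p 0) (q 0) = a := by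
  simp [latticeAbscissa, h.p_zero, h.q_zero]

theorem a_pos (h : IsFareyChain a b K p q) : 0 < a := by
  have := h.pos 0
  rwa [h.abscissa_zero] at this

theorem a_le_one (h : IsFareyChain a b K p q) : a ≤ 1 := by
  have := h.le_one 0
  rwa [h.abscissa_zero] at this

theorem abscissa_add_two (h : IsFareyChain a b K p q) (n : ℕ) :
    latticeAbscissa a b (p (n + 2)) (q (n + 2)) =
      K (n + 1) * latticeAbscissa a b (p (n + 1)) (q (n + 1)) - latticeAbscissa a b (p n) (q n) := by
  simp only [latticeAbscissa, h.p_add_two, h.q_add_two]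
  push_cast
  ring

/-- The linear map `(p, q) ↦ (p * a - q * b, q)` multiplies determinants by `a`. -/
theorem cross (h : IsFareyChain a b K p q) (n : ℕ) :
    q (n + 1) * latticeAbscissa a b (p n) (q n) -
      q n * latticeAbscissa a b (p (n + 1)) (q (n + 1)) = a := by
  have := congrArg (fun z : ℤ => (z : ℝ)) (h.det n)
  push_cast at this
  simp only [latticeAbscissa]
  linear_combination a * this

theorem slope_succ (h : IsFareyChain a b K p q) (n : ℕ) :
    q (n + 1) / latticeAbscissa a b (p (n + 1)) (q (n + 1)) =
      q n / latticeAbscissa a b (p n) (q n) +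
        a / (latticeAbscissa a b (p n) (q n) * latticeAbscissa a b (p (n + 1)) (q (n + 1))) := by
  have h1 := h.pos n
  have h2 := h.pos (n + 1)
  have := h.cross n
  field_simp
  linarith

theorem slope_add_le_slope_succ (h : IsFareyChain a b K p q) (n : ℕ) :
    q n / latticeAbscissa a b (p n) (q n) + a ≤
      q (n + 1) / latticeAbscissa a b (p (n + 1)) (q (n + 1)) := by
  rw [h.slope_succ]
  have h1 := h.pos n
  have h2 := h.pos (n + 1)
  gcongr
  rw [le_div_iff₀ (by positivity)]
  exact mul_le_of_le_one_right h.a_pos.le (mul_le_one₀ (h.le_one n) h2.le (h.le_one _))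

theorem mul_le_slope (h : IsFareyChain a b K p q) (n : ℕ) :
    a * n ≤ q n / latticeAbscissa a b (p n) (q n) := by
  induction n with
  | zero => simp [h.q_zero]
  | succ n ih =>
    have := h.slope_add_le_slope_succ n
    push_cast
    linarith

theorem q_nonneg (h : IsFareyChain a b K p q) (n : ℕ) : 0 ≤ q n := by
  have h1 := h.mul_le_slope n
  rw [le_div_iff₀ (h.pos n)] at h1
  have : (0 : ℝ) ≤ q n := le_trans (mul_nonneg (mul_nonneg h.a_pos.le n.cast_nonneg) (h.pos n).le) h1
  exact_mod_cast this

theorem q_pos (h : IsFareyChain a b K p q) {n : ℕ} (hn : 1 ≤ n) : 1 ≤ q n := by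
  have h1 := h.mul_le_slope n
  rw [le_div_iff₀ (h.pos n)] at h1
  have hn' : (0 : ℝ) < n := by exact_mod_cast hn
  have : (0 : ℝ) < q n := lt_of_lt_of_le (mul_pos (mul_pos h.a_pos hn') (h.pos n)) h1
  have : 0 < q n := by exact_mod_cast this
  omega

theorem p_pos (h : IsFareyChain a b K p q) (hb : 0 < b) (n : ℕ) : 0 < p n := by
  have h1 := h.pos n
  have h2 : (0 : ℝ) ≤ q n := by exact_mod_cast h.q_nonneg n
  have h3 := mul_nonneg h2 hb.le
  have h4 : 0 < (p n : ℝ) * a := by unfold latticeAbscissa at h1; linarith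
  exact_mod_cast pos_of_mul_pos_left h4 h.a_pos.le

/-- The partial sums of the coefficients are the Stern–Brocot weights, up to a constant. -/
theorem sternBrocotWeight_eq (h : IsFareyChain a b K p q) (hb : 0 < b) :
    ∃ B : ℤ, ∀ n, sternBrocotWeight (p n) (q n) (p (n + 1)) (q (n + 1)) =
      ∑ i ∈ Finset.range (n + 1), (K i - 3) + B := by
  refine ⟨sternBrocotWeight (p 0) (q 0) (p 1) (q 1) - (K 0 - 3), fun n => ?_⟩
  induction n with
  | zero => simp
  | succ n ih =>
    rw [Finset.sum_range_succ,
      sternBrocotWeight_step (p n + q n + p (n + 2) + q (n + 2)).toNat (h.p_pos hb n).le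
        (h.q_nonneg n) (h.p_pos hb (n + 1)).le (h.q_nonneg _) (h.p_pos hb (n + 2)).le
        (h.q_nonneg _) (h.det n) (k := K (n + 1)) (by rw [h.p_add_two]; ring)
        (by rw [h.q_add_two]; ring) (Int.self_le_toNat _), ih]
    ring

theorem exists_slope_le_lt (h : IsFareyChain a b K p q) {S : ℝ} (hS : 0 ≤ S) :
    ∃ n, q n / latticeAbscissa a b (p n) (q n) ≤ S ∧
      S < q (n + 1) / latticeAbscissa a b (p (n + 1)) (q (n + 1)) := by
  have hex : ∃ n : ℕ, S < q n / latticeAbscissa a b (p n) (q n) := by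
    obtain ⟨n, hn⟩ := exists_nat_gt (S / a)
    refine ⟨n, lt_of_lt_of_le ?_ (h.mul_le_slope n)⟩
    rw [div_lt_iff₀ h.a_pos] at hn
    linarith
  classical
  have h0 : Nat.find hex ≠ 0 := by
    intro h0
    have := Nat.find_spec hex
    rw [h0, h.q_zero] at this
    simp at this
    linarith
  obtain ⟨m, hm⟩ := Nat.exists_eq_succ_of_ne_zero h0
  refine ⟨m, not_lt.1 (Nat.find_min hex (by omega)), ?_⟩
  have := Nat.find_spec hex
  rwa [hm] at this

/-- Cramer's rule: coordinates of `(r, s)` in the unimodular basis of two consecutive chain vectors.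
They are nonnegative when the slope of `(r, s)` lies between the slopes of the basis. -/
theorem p_decomp (h : IsFareyChain a b K p q) (n : ℕ) (r s : ℤ) :
    (r * q (n + 1) - p (n + 1) * s) * p n + (p n * s - r * q n) * p (n + 1) = r := by
  linear_combination r * h.det n

theorem q_decomp (h : IsFareyChain a b K p q) (n : ℕ) (r s : ℤ) :
    (r * q (n + 1) - p (n + 1) * s) * q n + (p n * s - r * q n) * q (n + 1) = s := by
  linear_combination s * h.det n

theorem abscissa_decomp (h : IsFareyChain a b K p q) (n : ℕ) (r s : ℤ) :
    ((r * q (n + 1) - p (n + 1) * s : ℤ) : ℝ) * latticeAbscissa a b (p n) (q n) +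
      ((p n * s - r * q n : ℤ) : ℝ) * latticeAbscissa a b (p (n + 1)) (q (n + 1)) =
      latticeAbscissa a b r s := by
  have := congrArg (fun z : ℤ => (z : ℝ)) (h.det n)
  push_cast at this ⊢
  simp only [latticeAbscissa]
  linear_combination (r * a - s * b) * this

theorem coeff_nonneg_pos (h : IsFareyChain a b K p q) {n : ℕ} {r s : ℤ}
    (hx : 0 < latticeAbscissa a b r s)
    (h1 : q n / latticeAbscissa a b (p n) (q n) ≤ s / latticeAbscissa a b r s)
    (h2 : s / latticeAbscissa a b r s < q (n + 1) / latticeAbscissa a b (p (n + 1)) (q (n + 1))) :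
    0 ≤ p n * s - r * q n ∧ 0 < r * q (n + 1) - p (n + 1) * s := by
  have ha := h.a_pos
  rw [div_le_div_iff₀ (h.pos _) hx] at h1
  rw [div_lt_div_iff₀ hx (h.pos _)] at h2
  simp only [latticeAbscissa] at h1 h2
  constructor
  · have : 0 ≤ a * ((p n * s - r * q n : ℤ) : ℝ) := by push_cast; linarith
    exact_mod_cast nonneg_of_mul_nonneg_right this ha
  · have : 0 < a * ((r * q (n + 1) - p (n + 1) * s : ℤ) : ℝ) := by push_cast; linarith
    exact_mod_cast pos_of_mul_pos_right this ha.le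

/-- A chain in which consecutive abscissae add up to more than one contains all primitive vectors of
the strip. -/
theorem exists_eq (h : IsFareyChain a b K p q)
    (hsum : ∀ n, 1 < latticeAbscissa a b (p n) (q n) + latticeAbscissa a b (p (n + 1)) (q (n + 1)))
    {r s : ℤ} (hrs : IsCoprime r s) (hs : 0 ≤ s) (hx : 0 < latticeAbscissa a b r s)
    (hx1 : latticeAbscissa a b r s ≤ 1) : ∃ n, p n = r ∧ q n = s := by
  obtain ⟨n, h1, h2⟩ := h.exists_slope_le_lt (S := s / latticeAbscissa a b r s)
    (div_nonneg (by exact_mod_cast hs) hx.le)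
  obtain ⟨hβ, hα⟩ := h.coeff_nonneg_pos hx h1 h2
  have e := h.abscissa_decomp n r s
  have ep := h.p_decomp n r s
  have eq := h.q_decomp n r s
  set α := r * q (n + 1) - p (n + 1) * s
  set β := p n * s - r * q n
  -- With both coordinates at least `1`, the abscissa would exceed the sum of two consecutive ones,
  -- hence `1`.
  have hβ0 : β = 0 := by
    by_contra hne
    have h3 : (1 : ℝ) ≤ β := by exact_mod_cast (by omega : 1 ≤ β)
    have h4 : (1 : ℝ) ≤ α := by exact_mod_cast hα
    nlinarith [h.pos n, h.pos (n + 1), hsum n]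
  rw [hβ0] at ep eq
  simp only [zero_mul, add_zero] at ep eq
  have hu : IsUnit α := hrs.isUnit_of_dvd' ⟨_, ep.symm⟩ ⟨_, eq.symm⟩
  have hα1 : α = 1 := by
    rcases Int.isUnit_iff.1 hu with h | h <;> omega
  rw [hα1, one_mul] at ep eq
  exact ⟨n, ep, eq⟩

end IsFareyChain

/-! ### Linear growth of the slope -/

/-- Before a small abscissa `x m` the abscissae form an arithmetic progression. -/
theorem abscissa_progression {x : ℕ → ℝ} {K : ℕ → ℤ} (hpos : ∀ n, 0 < x n) (hle : ∀ n, x n ≤ 1)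
    (hsum : ∀ n, 1 < x n + x (n + 1)) (hrec : ∀ n, x (n + 2) = K (n + 1) * x (n + 1) - x n)
    {m : ℕ} (hm : x m < 1 / 8) (i : ℕ) : ∀ j, j + i + 2 = m → i * x m ≤ 1 / 4 →
      x (j + 1) = x (m - 1) - i * x m ∧ x j = x (m - 1) - (i + 1) * x m := by
  induction i with
  | zero =>
    intro j hj _
    subst hj
    simp only [add_zero, Nat.add_succ_sub_one, Nat.cast_zero, zero_mul, sub_zero, zero_add, one_mul,
      true_and]
    have h1 := hrec j
    have h2 := hsum (j + 1)
    have h3 := hpos (j + 2)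
    have h4 := hle (j + 1)
    have h5 := hle j
    have h6 := hpos j
    -- A coefficient of at least `2` would give `x m ≥ 2 * x (m - 1) - 1 > 3 / 4`.
    have h7 : K (j + 1) = 1 := by
      have hl : 0 < (K (j + 1) : ℝ) := by
        by_contra hcon
        nlinarith
      have hu : (K (j + 1) : ℝ) < 2 := by
        by_contra! hcon
        have h8 : 2 * x (j + 1) ≤ K (j + 1) * x (j + 1) := by gcongr; exact (hpos _).le
        simp only [add_zero] at hm
        linarith
      have hl' : 0 < K (j + 1) := by exact_mod_cast hl
      have hu' : K (j + 1) < 2 := by exact_mod_cast hu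
      omega
    rw [h7] at h1
    simp only [Int.cast_one, one_mul] at h1
    linarith
  | succ i ih =>
    intro j hj hi
    push_cast at hi ⊢
    have h0 := hpos m
    obtain ⟨h1, h2⟩ := ih (j + 1) (by omega) (by nlinarith)
    have h3 : 1 < x (m - 1) + x m := by
      have := hsum (m - 1)
      rwa [show m - 1 + 1 = m by omega] at this
    have h4 := hrec j
    have h5 := hsum j
    have h6 := hle j
    have h7 := hpos (j + 1)
    have hy : 5 / 8 < x (j + 1) := by rw [h2]; linarith
    -- A coefficient of at most `1` would contradict that `x (j + 2)` exceeds `x (j + 1)` by `x m`;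
    -- one of at least `3` would make `x j` exceed `1`.
    have h8 : K (j + 1) = 2 := by
      have hl : 1 < (K (j + 1) : ℝ) := by
        by_contra! hcon
        have h8 : K (j + 1) * x (j + 1) ≤ 1 * x (j + 1) := by gcongr
        have h9 : x (j + 2) = x (m - 1) - i * x m := h1
        linarith [hpos j]
      have hu : (K (j + 1) : ℝ) < 3 := by
        by_contra! hcon
        have h8 : 3 * x (j + 1) ≤ K (j + 1) * x (j + 1) := by gcongr
        linarith
      have hl' : 1 < K (j + 1) := by exact_mod_cast hl
      have hu' : K (j + 1) < 3 := by exact_mod_cast hu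
      omega
    rw [h8] at h4
    push_cast at h4
    exact ⟨by linarith, by linarith⟩

theorem half_le_before_small_abscissa {x : ℕ → ℝ} {K : ℕ → ℤ} (hpos : ∀ n, 0 < x n)
    (hle : ∀ n, x n ≤ 1) (hsum : ∀ n, 1 < x n + x (n + 1))
    (hrec : ∀ n, x (n + 2) = K (n + 1) * x (n + 1) - x n)
    {m : ℕ} (hm : x m < 1 / 8) {N : ℕ} (hN : N * x m ≤ 1 / 4) {t : ℕ} (ht : t < m)
    (htN : m ≤ t + N + 1) : 1 / 2 ≤ x t := by
  have h3 : 1 < x (m - 1) + x m := by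
    have := hsum (m - 1)
    rwa [show m - 1 + 1 = m by omega] at this
  rcases eq_or_ne (t + 1) m with h | h
  · obtain rfl : t = m - 1 := by omega
    linarith
  · have hi : ((m - 2 - t : ℕ) : ℝ) * x m ≤ 1 / 4 := by
      refine le_trans ?_ hN
      have := (hpos m).le
      gcongr
      omega
    have := (abscissa_progression hpos hle hsum hrec hm (m - 2 - t) t (by omega) hi).2
    linarith

/-- A large term `1 / x m` is paid for by the roughly `1 / (4 * x m)` terms before it, each at most
`2`. If that block reaches back to index `0`, the arithmetic progression covers the whole start and
`x m = x 1 - x 0`, whence the last constant. -/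
theorem sum_inv_abscissa_le {x : ℕ → ℝ} {K : ℕ → ℤ} (hpos : ∀ n, 0 < x n)
    (hle : ∀ n, x n ≤ 1) (hsum : ∀ n, 1 < x n + x (n + 1))
    (hrec : ∀ n, x (n + 2) = K (n + 1) * x (n + 1) - x n) (m : ℕ) :
    ∑ i ∈ Finset.range (m + 1), 1 / x i ≤
      10 * (m + 1) + (1 / x 0 + 1 / x 1 + |1 / (x 1 - x 0)|) := by
  induction m using Nat.strong_induction_on with
  | _ m ih =>
    have h0 := one_div_pos.2 (hpos 0)
    have h1 := one_div_pos.2 (hpos 1)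
    have h2 := abs_nonneg (1 / (x 1 - x 0))
    rcases Nat.lt_or_ge m 2 with hm2 | hm2
    · interval_cases m
      · rw [zero_add, Finset.sum_range_one]
        push_cast
        linarith
      · rw [Finset.sum_range_succ, Finset.sum_range_one]
        push_cast
        linarith
    rcases le_or_gt (1 / 8) (x m) with hx | hx
    · obtain ⟨m, rfl⟩ : ∃ k, m = k + 1 := ⟨m - 1, by omega⟩
      have := ih m (by omega)
      rw [Finset.sum_range_succ]
      have h3 : 1 / x (m + 1) ≤ 8 := by
        rw [div_le_iff₀ (hpos _)]; linarith
      push_cast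
      linarith
    · have hδ := hpos m
      obtain ⟨N, hN1, hN2⟩ : ∃ N : ℕ, (N : ℝ) ≤ 1 / (4 * x m) ∧ 1 / (4 * x m) < N + 1 :=
        ⟨⌊1 / (4 * x m)⌋₊, Nat.floor_le (by positivity), Nat.lt_floor_add_one _⟩
      have hN3 : N * x m ≤ 1 / 4 := by
        rw [le_div_iff₀ (by positivity)] at hN1
        linarith
      have hN4 : 1 / x m ≤ 4 * N + 4 := by
        have : 1 / (4 * x m) = 1 / x m / 4 := by field_simp
        linarith
      have hhalf : ∀ t, t < m → m ≤ t + N + 1 → 1 / x t ≤ 2 := by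
        intro t ht htN
        have := half_le_before_small_abscissa hpos hle hsum hrec hx hN3 ht htN
        rw [div_le_iff₀ (hpos _)]
        linarith
      rw [Finset.sum_range_succ]
      rcases Nat.lt_or_ge N m with hNm | hNm
      -- The block of `N + 1` terms contributes at most `2 * N + (4 * N + 4) ≤ 10 * (N + 1)`.
      · obtain ⟨j, rfl⟩ : ∃ j, m = j + 1 + N := ⟨m - 1 - N, by omega⟩
        rw [Finset.sum_range_add]
        have h3 : ∑ i ∈ Finset.range N, 1 / x (j + 1 + i) ≤ N * 2 := by
          have := Finset.sum_le_card_nsmul (Finset.range N) (fun i => 1 / x (j + 1 + i)) 2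
            (fun i hi => by
              rw [Finset.mem_range] at hi
              exact hhalf _ (by omega) (by omega))
          simpa using this
        have h4 := ih j (by omega)
        push_cast
        linarith
      · have h3 : ∑ i ∈ Finset.range m, 1 / x i ≤ m * 2 := by
          have := Finset.sum_le_card_nsmul (Finset.range m) (fun i => 1 / x i) 2
            (fun i hi => by
              rw [Finset.mem_range] at hi
              exact hhalf _ (by omega) (by omega))
          simpa using this
        have hi : ((m - 2 : ℕ) : ℝ) * x m ≤ 1 / 4 := by
          refine le_trans ?_ hN3
          gcongr
          omega
        obtain ⟨h5, h6⟩ := abscissa_progression hpos hle hsum hrec hx (m - 2) 0 (by omega) hi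
        have h7 : x 1 - x 0 = x m := by rw [zero_add] at h5; linarith
        have h8 := le_abs_self (1 / (x 1 - x 0))
        have h9 : 1 / (x 1 - x 0) = 1 / x m := by rw [h7]
        have : (0 : ℝ) ≤ m := m.cast_nonneg
        linarith

/-- The slope increment `a / (x n * x (n + 1))` is at most `a / x n + a / x (n + 1)` because the two
abscissae sum to more than `1`; the sum of reciprocals is linear in `n`. -/
theorem IsFareyChain.slope_le {a b : ℝ} {K p q : ℕ → ℤ} (h : IsFareyChain a b K p q)
    (hsum : ∀ n, 1 < latticeAbscissa a b (p n) (q n) + latticeAbscissa a b (p (n + 1)) (q (n + 1))) :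
    ∃ C : ℝ, 0 < C ∧ ∀ n : ℕ, q n / latticeAbscissa a b (p n) (q n) ≤ C * (n + 1) := by
  set x : ℕ → ℝ := fun n => latticeAbscissa a b (p n) (q n) with hxdef
  have hb := sum_inv_abscissa_le (x := x) (K := K) h.pos h.le_one hsum h.abscissa_add_two
  set C' := 1 / x 0 + 1 / x 1 + |1 / (x 1 - x 0)| with hC'
  have hC0 : 0 ≤ C' := by
    have h0 := one_div_pos.2 (h.pos 0)
    have h1 := one_div_pos.2 (h.pos 1)
    positivity
  have ha := h.a_pos
  have key : ∀ n, q n / x n ≤ 2 * a * ∑ i ∈ Finset.range (n + 1), 1 / x i - a / x n := by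
    intro n
    induction n with
    | zero =>
      have := h.pos 0
      have : 0 < a / x 0 := div_pos ha this
      rw [zero_add, Finset.sum_range_one, h.q_zero, Int.cast_zero, zero_div,
        show 2 * a * (1 / x 0) - a / x 0 = a / x 0 by ring]
      exact this.le
    | succ n ih =>
      rw [Finset.sum_range_succ]
      have h1 := h.pos n
      have h2 := h.pos (n + 1)
      have h3 : a / (x n * x (n + 1)) ≤ a / x n + a / x (n + 1) := by
        rw [div_add_div _ _ h1.ne' h2.ne']
        refine div_le_div_of_nonneg_right ?_ (mul_pos h1 h2).le
        calc a = a * 1 := (mul_one a).symm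
          _ ≤ a * (x n + x (n + 1)) := by gcongr; exact (hsum n).le
          _ = _ := by ring
      have h4 := h.slope_succ n
      simp only [hxdef] at *
      have e1 : a / latticeAbscissa a b (p (n + 1)) (q (n + 1)) =
        a * (1 / latticeAbscissa a b (p (n + 1)) (q (n + 1))) := by ring
      linarith
  refine ⟨2 * a * (10 + C'), by positivity, fun n => ?_⟩
  have h1 := div_pos ha (h.pos n)
  calc (q n : ℝ) / x n ≤ 2 * a * ∑ i ∈ Finset.range (n + 1), 1 / x i := by linarith [key n]
    _ ≤ 2 * a * (10 * (n + 1) + C') := by gcongr; exact hb n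
    _ ≤ 2 * a * (10 + C') * (n + 1) := by
      have hn : (0 : ℝ) ≤ n := n.cast_nonneg
      rw [mul_assoc (2 * a)]
      exact mul_le_mul_of_nonneg_left (by nlinarith [mul_nonneg hC0 hn]) (by positivity)

/-! ### Construction of the two chains -/

/-- The solution of the recursion `x (n + 2) = K n * x (n + 1) - x n` with the given initial
values. -/
def continuantSeq {R : Type*} [Ring R] (K : ℕ → ℤ) (u v : R) : ℕ → R
  | 0 => u
  | 1 => v
  | n + 2 => K n * continuantSeq K u v (n + 1) - continuantSeq K u v n

/-- `b` and `a` are the abscissae of `(0, -1)` and `(1, 0)`, and the recursion carries the integer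
vectors along. The chain drops the first vector, hence the shift of index. -/
theorem exists_isFareyChain {a b : ℝ} {K : ℕ → ℤ} {y : ℕ → ℝ} (h0 : y 0 = b) (h1 : y 1 = a)
    (hrec : ∀ n, y (n + 2) = K n * y (n + 1) - y n) (hpos : ∀ n, 0 < y (n + 1))
    (hle : ∀ n, y (n + 1) ≤ 1) :
    ∃ p q : ℕ → ℤ, IsFareyChain a b K p q ∧ ∀ n, latticeAbscissa a b (p n) (q n) = y (n + 1) := by
  set P : ℕ → ℤ := continuantSeq K 0 1
  set Q : ℕ → ℤ := continuantSeq K (-1) 0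
  have hP : ∀ n, P (n + 2) = K n * P (n + 1) - P n := fun n => by
    simp only [P, continuantSeq]; simp
  have hQ : ∀ n, Q (n + 2) = K n * Q (n + 1) - Q n := fun n => by
    simp only [Q, continuantSeq]; simp
  have key : ∀ n, latticeAbscissa a b (P n) (Q n) = y n ∧
      latticeAbscissa a b (P (n + 1)) (Q (n + 1)) = y (n + 1) := by
    intro n
    induction n with
    | zero => simp [latticeAbscissa, P, Q, continuantSeq, h0, h1]
    | succ n ih =>
      refine ⟨ih.2, ?_⟩
      rw [hrec, ← ih.1, ← ih.2, hP, hQ]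
      simp only [latticeAbscissa]
      push_cast
      ring
  refine ⟨fun n => P (n + 1), fun n => Q (n + 1), ?_, fun n => (key n).2⟩
  exact
    { p_zero := by simp [P, continuantSeq]
      q_zero := by simp [Q, continuantSeq]
      p_one := by simp [P, continuantSeq]
      q_one := by simp [Q, continuantSeq]
      p_add_two := fun n => hP (n + 1)
      q_add_two := fun n => hQ (n + 1)
      pos := fun n => (key n).2 ▸ hpos n
      le_one := fun n => (key n).2 ▸ hle n }

/-- The pairs of consecutive remainders of the minus continued fraction algorithm. -/
noncomputable def minusRemainders (a b : ℝ) (n : ℕ) : ℝ × ℝ :=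
  (fun z : ℝ × ℝ => (z.2, ⌈z.1 / z.2⌉ * z.2 - z.1))^[n] (b, a)

theorem minusRemainders_succ (a b : ℝ) (n : ℕ) :
    minusRemainders a b (n + 1) = ((minusRemainders a b n).2,
      ⌈(minusRemainders a b n).1 / (minusRemainders a b n).2⌉ * (minusRemainders a b n).2 -
        (minusRemainders a b n).1) := by
  rw [minusRemainders, Function.iterate_succ_apply']
  rfl

/-- The minus continued fraction of `b / a`: a chain with decreasing abscissae. -/
theorem exists_isFareyChain_strictAnti {a b : ℝ} (ha : 0 < a) (ha1 : a ≤ 1)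
    (hirr : Irrational (b / a)) : ∃ K p q : ℕ → ℤ, IsFareyChain a b K p q ∧
      StrictAnti fun n => latticeAbscissa a b (p n) (q n) := by
  have key : ∀ n, 0 < (minusRemainders a b n).2 ∧
      Irrational ((minusRemainders a b n).1 / (minusRemainders a b n).2) := by
    intro n
    induction n with
    | zero => exact ⟨ha, hirr⟩
    | succ n ih =>
      rw [minusRemainders_succ]
      obtain ⟨hv, ht⟩ := ih
      set u := (minusRemainders a b n).1
      set v := (minusRemainders a b n).2
      have h1 : 0 < ⌈u / v⌉ - u / v :=
        sub_pos.2 (lt_of_le_of_ne (Int.le_ceil _) (ht.ne_int _))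
      have h2 : ⌈u / v⌉ * v - u = v * (⌈u / v⌉ - u / v) := by field_simp
      simp only
      rw [h2]
      refine ⟨mul_pos hv h1, ?_⟩
      have h3 : v / (v * (⌈u / v⌉ - u / v)) = (⌈u / v⌉ - u / v)⁻¹ := by field_simp
      rw [h3]
      exact (ht.intCast_sub _).inv
  have hlt : ∀ n, (minusRemainders a b (n + 1)).2 < (minusRemainders a b n).2 := by
    intro n
    rw [minusRemainders_succ]
    obtain ⟨hv, -⟩ := key n
    have h1 := Int.ceil_lt_add_one ((minusRemainders a b n).1 / (minusRemainders a b n).2)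
    rw [← sub_lt_iff_lt_add, lt_div_iff₀ hv] at h1
    simp only
    linarith
  have hle : ∀ n, (minusRemainders a b n).2 ≤ 1 := by
    intro n
    induction n with
    | zero => exact ha1
    | succ n ih => exact (hlt n).le.trans ih
  have hfst : ∀ n, (minusRemainders a b (n + 1)).1 = (minusRemainders a b n).2 := fun n => by
    rw [minusRemainders_succ]
  obtain ⟨p, q, h, hy⟩ := exists_isFareyChain (a := a) (b := b)
    (K := fun n => ⌈(minusRemainders a b n).1 / (minusRemainders a b n).2⌉)
    (y := fun n => (minusRemainders a b n).1) rfl rfl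
    (fun n => by rw [hfst, hfst, minusRemainders_succ])
    (fun n => by rw [hfst]; exact (key n).1) (fun n => by rw [hfst]; exact hle n)
  refine ⟨_, p, q, h, strictAnti_nat_of_succ_lt fun n => ?_⟩
  rw [hy, hy, hfst, hfst]
  exact hlt n

/-- The backward orbit of the BCZ map, as a chain of lattice vectors. -/
theorem exists_isFareyChain_itinerary {a b : ℝ} (hab : (a, b) ∈ fareyTriangle) :
    ∃ K p q : ℕ → ℤ, IsFareyChain a b K p q ∧
      (∀ n, 1 < latticeAbscissa a b (p n) (q n) + latticeAbscissa a b (p (n + 1)) (q (n + 1))) ∧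
      ∀ n, backwardSum ⟨(a, b), hab⟩ n = ∑ i ∈ Finset.range (n + 1), (K i - 3) := by
  set z : ℕ → fareyTriangle := fun n => (bczPerm ^ (-(n : ℤ))) ⟨(a, b), hab⟩ with hz
  have hz0 : z 0 = ⟨(a, b), hab⟩ := by
    simp only [hz, Nat.cast_zero, neg_zero, zpow_zero, Equiv.Perm.one_apply]
  have hT : ∀ n, bczMap (z (n + 1)) = z n := by
    intro n
    have : bczPerm (z (n + 1)) = z n := by
      simp only [hz]
      rw [← Equiv.Perm.mul_apply, ← zpow_one_add]
      congr 2
      push_cast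
      ring
    exact congrArg Subtype.val this
  set y : ℕ → ℝ := fun n => (z n : ℝ × ℝ).2 with hy
  have hy1 : ∀ n, y (n + 1) = (z n : ℝ × ℝ).1 := fun n => congrArg Prod.fst (hT n)
  obtain ⟨p, q, h, hx⟩ := exists_isFareyChain (a := a) (b := b)
    (K := fun n => bczIndex (z (n + 1) : fareyTriangle)) (y := y)
    (by simp only [hy, hz0]) (by rw [hy1, hz0])
    (fun n => by
      have := congrArg Prod.snd (hT n)
      simp only [bczMap] at this
      rw [hy1 (n + 1)]
      simp only [hy]
      linarith)
    (fun n => by rw [hy1]; exact (z n).2.1.1) (fun n => by rw [hy1]; exact (z n).2.1.2)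
  refine ⟨_, p, q, h, fun n => ?_, fun n => ?_⟩
  · rw [hx, hx, hy1 n, add_comm]
    have h1 := (z (n + 1)).2.2.2
    rw [← hy1 (n + 1)] at h1
    have h2 : (z (n + 1) : ℝ × ℝ).2 = (z n : ℝ × ℝ).1 := by rw [← hy1 n]
    rwa [h2] at h1
  -- The term `k_{-i}` is the index at `T^(-i-1)`, which is the coefficient `K i`.
  · rw [backwardSum]
    refine Finset.sum_congr rfl fun i _ => ?_
    rw [itinerary, hz]
    simp only
    congr 5
    push_cast
    ring

/-! ### Growth along the minus continued fraction -/

namespace IsFareyChain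

variable {a b : ℝ} {K p q : ℕ → ℤ}

theorem two_le_coeff (h : IsFareyChain a b K p q)
    (hanti : StrictAnti fun n => latticeAbscissa a b (p n) (q n)) (n : ℕ) : 2 ≤ K (n + 1) := by
  have h1 := h.abscissa_add_two n
  have h2 := h.pos (n + 2)
  have h3 := h.pos (n + 1)
  have h4 : latticeAbscissa a b (p (n + 1)) (q (n + 1)) < latticeAbscissa a b (p n) (q n) :=
    hanti (Nat.lt_succ_self n)
  have h5 : (1 : ℝ) < K (n + 1) := by
    by_contra! hcon
    nlinarith
  have : 1 < K (n + 1) := by exact_mod_cast h5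
  omega

/-- The drop from `x i` to `x (i + 1)` exceeds the next drop by `(K (i + 1) - 2) * x (i + 1)`. These
excesses total at most `a`, and every abscissa involved is at least `x n`. -/
theorem sum_coeff_sub_two_le (h : IsFareyChain a b K p q)
    (hanti : StrictAnti fun n => latticeAbscissa a b (p n) (q n)) (n : ℕ) :
    ((∑ i ∈ Finset.range n, (K (i + 1) - 2) : ℤ) : ℝ) ≤ 1 / latticeAbscissa a b (p n) (q n) := by
  have h2 := fun i => h.two_le_coeff hanti i
  have key : ((∑ i ∈ Finset.range n, (K (i + 1) - 2) : ℤ) : ℝ) * latticeAbscissa a b (p n) (q n) +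
      (latticeAbscissa a b (p n) (q n) - latticeAbscissa a b (p (n + 1)) (q (n + 1))) ≤ a := by
    induction n with
    | zero =>
      have := h.pos 1
      simp [h.abscissa_zero]
      exact this.le
    | succ n ih =>
      rw [Finset.sum_range_succ, h.abscissa_add_two]
      have hs : (0 : ℝ) ≤ ((∑ i ∈ Finset.range n, (K (i + 1) - 2) : ℤ) : ℝ) := by
        exact_mod_cast Finset.sum_nonneg fun i _ => by linarith [h2 i]
      have h4 : latticeAbscissa a b (p (n + 1)) (q (n + 1)) < latticeAbscissa a b (p n) (q n) :=
        hanti (Nat.lt_succ_self n)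
      have := mul_le_mul_of_nonneg_left h4.le hs
      rw [Int.cast_add]
      push_cast at *
      linarith
  have h4 : latticeAbscissa a b (p (n + 1)) (q (n + 1)) < latticeAbscissa a b (p n) (q n) :=
    hanti (Nat.lt_succ_self n)
  rw [le_div_iff₀ (h.pos n)]
  linarith [h.a_le_one]

theorem abs_sum_coeff_sub_three_le (h : IsFareyChain a b K p q)
    (hanti : StrictAnti fun n => latticeAbscissa a b (p n) (q n)) (n : ℕ) :
    |((∑ i ∈ Finset.range (n + 1), (K i - 3) : ℤ) : ℝ)| ≤
      |(K 0 : ℝ) - 3| + 1 / latticeAbscissa a b (p n) (q n) + n := by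
  have h1 := h.sum_coeff_sub_two_le hanti n
  have h2 : (0 : ℝ) ≤ ((∑ i ∈ Finset.range n, (K (i + 1) - 2) : ℤ) : ℝ) := by
    exact_mod_cast Finset.sum_nonneg fun i _ => by linarith [h.two_le_coeff hanti i]
  have h3 : ∑ i ∈ Finset.range (n + 1), (K i - 3) =
      (∑ i ∈ Finset.range n, (K (i + 1) - 2)) - n + (K 0 - 3) := by
    rw [Finset.sum_range_succ']
    congr 1
    rw [eq_sub_iff_add_eq]
    have : (n : ℤ) = ∑ i ∈ Finset.range n, 1 := by simp
    rw [this, ← Finset.sum_add_distrib]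
    exact Finset.sum_congr rfl fun i _ => by ring
  rw [h3]
  have h4 := neg_abs_le ((K 0 : ℝ) - 3)
  have h5 := le_abs_self ((K 0 : ℝ) - 3)
  have h6 : (0 : ℝ) ≤ n := n.cast_nonneg
  rw [Int.cast_add, Int.cast_sub, Int.cast_sub, Int.cast_natCast]
  have h7 := one_div_pos.2 (h.pos n)
  rw [abs_le]
  push_cast at *
  constructor <;> linarith

theorem one_le_q_diff (h : IsFareyChain a b K p q)
    (hanti : StrictAnti fun n => latticeAbscissa a b (p n) (q n)) (n : ℕ) :
    1 ≤ q (n + 1) - q n := by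
  induction n with
  | zero => simp [h.q_zero, h.q_one]
  | succ n ih =>
    rw [h.q_add_two]
    have := h.two_le_coeff hanti n
    have := h.q_nonneg (n + 1)
    nlinarith

theorem q_diff_cross (h : IsFareyChain a b K p q) (n : ℕ) :
    ((q (n + 1) - q n : ℤ) : ℝ) * latticeAbscissa a b (p n) (q n) +
      q n * (latticeAbscissa a b (p n) (q n) - latticeAbscissa a b (p (n + 1)) (q (n + 1))) = a := by
  have := h.cross n
  push_cast
  linarith

end IsFareyChain

/-- A discrete form of `d(Q ^ σ) = σ * Q ^ (σ - 1) dQ`: increments of order `Q ^ (1 - σ)` raise `Q ^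
σ` by a constant. This is what counts the steps of the algorithm. -/
theorem rpow_add_le_rpow_of_add_le {Q Q' c σ : ℝ} (hQ : 1 ≤ Q) (hc : 0 < c) (hc1 : c ≤ 1)
    (hσ : 0 < σ) (h : Q + c * Q ^ (1 - σ) ≤ Q') : Q ^ σ + σ * c / 2 ≤ Q' ^ σ := by
  have hQ0 : 0 < Q := by linarith
  set y := c * Q ^ (-σ) with hy
  have hy0 : 0 < y := by positivity
  have hy1 : y ≤ 1 := by
    have : Q ^ (-σ) ≤ 1 := Real.rpow_le_one_of_one_le_of_nonpos hQ (by linarith)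
    calc y ≤ 1 * 1 := by rw [hy]; gcongr
      _ = 1 := one_mul 1
  have e1 : Q + c * Q ^ (1 - σ) = Q * (1 + y) := by
    rw [hy, sub_eq_add_neg, Real.rpow_add hQ0, Real.rpow_one]; ring
  have e2 : Q ^ σ * y = c := by
    rw [hy, mul_left_comm, ← Real.rpow_add hQ0]; simp
  -- From `log (1 + y) ≥ y / (1 + y) ≥ y / 2` for `0 < y ≤ 1`.
  have h3 : 1 + σ * y / 2 ≤ (1 + y) ^ σ := by
    rw [Real.rpow_def_of_pos (by linarith)]
    have h4 := Real.add_one_le_exp (Real.log (1 + y) * σ)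
    have h5 := Real.one_sub_inv_le_log_of_pos (show 0 < 1 + y by linarith)
    have h6 : y / 2 ≤ 1 - (1 + y)⁻¹ := by
      rw [show 1 - (1 + y)⁻¹ = y / (1 + y) by field_simp; ring]
      gcongr
      linarith
    nlinarith
  calc Q ^ σ + σ * c / 2 = Q ^ σ * (1 + σ * y / 2) := by rw [← e2]; ring
    _ ≤ Q ^ σ * (1 + y) ^ σ := by gcongr
    _ = (Q + c * Q ^ (1 - σ)) ^ σ := by rw [e1, Real.mul_rpow hQ0.le (by linarith)]
    _ ≤ Q' ^ σ := by
      refine Real.rpow_le_rpow ?_ h hσ.le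
      rw [e1]; positivity

/-- The rationals above `b / a` are not approximated too well. -/
def UpperApproxBound (a b ρ : ℝ) : Prop :=
  ∃ C : ℝ, 1 ≤ C ∧ ∀ p q : ℤ, IsCoprime p q → 1 ≤ q → 0 < latticeAbscissa a b p q →
    (1 / latticeAbscissa a b p q) ^ (1 - ρ) ≤ C * (q : ℝ) ^ ρ

/-- The rationals below `b / a` are not approximated too well. -/
def LowerApproxBound (a b ρ : ℝ) : Prop :=
  ∃ C : ℝ, 1 ≤ C ∧ ∀ p q : ℤ, IsCoprime p q → 1 ≤ q → latticeAbscissa a b p q < 0 →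
    (1 / -latticeAbscissa a b p q) ^ (1 - ρ) ≤ C * (q : ℝ) ^ (1 + ρ)

namespace IsFareyChain

variable {a b : ℝ} {K p q : ℕ → ℤ}

theorem isCoprime (h : IsFareyChain a b K p q) (n : ℕ) : IsCoprime (p n) (q n) :=
  ⟨q (n + 1), -p (n + 1), by linarith [h.det n, mul_comm (p n) (q (n + 1))]⟩

/-- The difference of consecutive vectors is primitive and lies below the line, with abscissa of
absolute value at most `1 / q n`. The bound on lower approximation then forces its denominator `L`
to satisfy `q n ^ (1 - ρ) ≤ C * L ^ (1 + ρ)`. -/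
theorem rpow_q_le_q_diff (h : IsFareyChain a b K p q)
    (hanti : StrictAnti fun n => latticeAbscissa a b (p n) (q n)) {ρ : ℝ} (hρ : 0 < ρ) (hρ1 : ρ ≤ 1)
    (hlow : LowerApproxBound a b ρ) : ∃ c : ℝ, 0 < c ∧ c ≤ 1 ∧ ∀ n, 1 ≤ n →
      c * (q n : ℝ) ^ (1 - 2 * ρ / (1 + ρ)) ≤ ((q (n + 1) - q n : ℤ) : ℝ) := by
  obtain ⟨C, hC, hlow⟩ := hlow
  have hC0 : 0 < C := by linarith
  refine ⟨C ^ (-(1 / (1 + ρ))), by positivity,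
    Real.rpow_le_one_of_one_le_of_nonpos hC (by rw [neg_nonpos]; positivity), fun n hn => ?_⟩
  set L : ℤ := q (n + 1) - q n with hL
  have hL1 : 1 ≤ L := h.one_le_q_diff hanti n
  have hL0 : (0 : ℝ) < L := by exact_mod_cast (by omega : 0 < L)
  have hQ : (1 : ℝ) ≤ q n := by exact_mod_cast h.q_pos hn
  have hlt : latticeAbscissa a b (p (n + 1)) (q (n + 1)) < latticeAbscissa a b (p n) (q n) :=
    hanti (Nat.lt_succ_self n)
  have hd : latticeAbscissa a b (p (n + 1) - p n) L =
      -(latticeAbscissa a b (p n) (q n) - latticeAbscissa a b (p (n + 1)) (q (n + 1))) := by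
    simp only [latticeAbscissa, hL]; push_cast; ring
  have hcop : IsCoprime (p (n + 1) - p n) L :=
    ⟨-q n, p n, by rw [hL]; linarith [h.det n, mul_comm (p (n + 1)) (q n)]⟩
  have h1 := hlow _ _ hcop hL1 (by rw [hd]; linarith)
  rw [hd, neg_neg] at h1
  set d := latticeAbscissa a b (p n) (q n) - latticeAbscissa a b (p (n + 1)) (q (n + 1))
  have hd0 : 0 < d := sub_pos.2 hlt
  have hQd : (q n : ℝ) ≤ 1 / d := by
    rw [le_div_iff₀ hd0]
    have h2 := h.q_diff_cross n
    have h3 := mul_pos hL0 (h.pos n)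
    have h4 := h.a_le_one
    linarith
  have h5 : (q n : ℝ) ^ (1 - ρ) ≤ C * (L : ℝ) ^ (1 + ρ) :=
    (Real.rpow_le_rpow (by linarith) hQd (by linarith)).trans h1
  have h6 : ((q n : ℝ) ^ (1 - ρ) / C) ^ (1 / (1 + ρ)) ≤ ((L : ℝ) ^ (1 + ρ)) ^ (1 / (1 + ρ)) := by
    refine Real.rpow_le_rpow (by positivity) ?_ (by positivity)
    rw [div_le_iff₀ hC0]; linarith
  rw [← Real.rpow_mul hL0.le, mul_one_div_cancel (by positivity), Real.rpow_one,
    Real.div_rpow (by positivity) hC0.le, ← Real.rpow_mul (by linarith)] at h6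
  have e : 1 - 2 * ρ / (1 + ρ) = (1 - ρ) * (1 / (1 + ρ)) := by field_simp; ring
  rw [e, Real.rpow_neg hC0.le, mul_comm, ← div_eq_mul_inv]
  exact h6

/-- The number of steps of the minus continued fraction algorithm. -/
theorem natCast_le_slope_rpow (h : IsFareyChain a b K p q)
    (hanti : StrictAnti fun n => latticeAbscissa a b (p n) (q n)) {ρ : ℝ} (hρ : 0 < ρ) (hρ1 : ρ ≤ 1)
    (hlow : LowerApproxBound a b ρ) : ∃ C : ℝ, 0 < C ∧ ∀ n : ℕ, 1 ≤ n →
      (n : ℝ) ≤ C * (q n / latticeAbscissa a b (p n) (q n)) ^ ρ := by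
  obtain ⟨c, hc, hc1, hL⟩ := h.rpow_q_le_q_diff hanti hρ hρ1 hlow
  -- The denominators grow by at least `c * q n ^ (1 - σ)`, so `n` is `O(q n ^ σ)`. The slope is at
  -- least `c * q n ^ (2 - σ)`, and `(2 - σ) * ρ = σ`.
  set σ := 2 * ρ / (1 + ρ) with hσdef
  have hσ : 0 < σ := by positivity
  have hcount : ∀ n : ℕ, 1 ≤ n → σ * c / 2 * n ≤ (q n : ℝ) ^ σ := by
    intro n hn
    induction n, hn using Nat.le_induction with
    | base =>
      have h1 : σ ≤ 1 := by rw [hσdef, div_le_one (by positivity)]; linarith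
      rw [h.q_one]
      push_cast
      rw [Real.one_rpow]
      nlinarith
    | succ n hn ih =>
      have hQ : (1 : ℝ) ≤ q n := by exact_mod_cast h.q_pos hn
      have := rpow_add_le_rpow_of_add_le (Q' := q (n + 1)) hQ hc hc1 hσ
        (by have := hL n hn; push_cast at this; linarith)
      push_cast
      linarith
  refine ⟨1 / (σ * c / 2) / c ^ ρ, by positivity, fun n hn => ?_⟩
  have hQ : (1 : ℝ) ≤ q n := by exact_mod_cast h.q_pos hn
  have hQ0 : (0 : ℝ) < q n := by linarith
  have hX := h.pos n
  have h1 : c * (q n : ℝ) ^ (2 - σ) ≤ q n / latticeAbscissa a b (p n) (q n) := by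
    rw [le_div_iff₀ hX]
    have h2 := h.q_diff_cross n
    have hlt : latticeAbscissa a b (p (n + 1)) (q (n + 1)) < latticeAbscissa a b (p n) (q n) :=
      hanti (Nat.lt_succ_self n)
    have h3 := mul_nonneg hQ0.le (sub_pos.2 hlt).le
    have h4 := mul_le_mul_of_nonneg_right (hL n hn) hX.le
    have e : (q n : ℝ) ^ (2 - σ) = q n * (q n : ℝ) ^ (1 - σ) := by
      rw [show 2 - σ = 1 + (1 - σ) by ring, Real.rpow_add hQ0, Real.rpow_one]
    rw [e]
    calc c * (q n * (q n : ℝ) ^ (1 - σ)) * latticeAbscissa a b (p n) (q n)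
        = q n * (c * (q n : ℝ) ^ (1 - σ) * latticeAbscissa a b (p n) (q n)) := by ring
      _ ≤ q n * 1 := by
        gcongr
        linarith [h.a_le_one]
      _ = q n := mul_one _
  have h2 := Real.rpow_le_rpow (by positivity) h1 hρ.le
  rw [Real.mul_rpow hc.le (by positivity), ← Real.rpow_mul hQ0.le,
    show (2 - σ) * ρ = σ by rw [hσdef]; field_simp; ring] at h2
  have h3 := hcount n hn
  calc (n : ℝ) = 1 / (σ * c / 2) * (σ * c / 2 * n) := by field_simp
    _ ≤ 1 / (σ * c / 2) * (q n : ℝ) ^ σ := by gcongr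
    _ = 1 / (σ * c / 2) / c ^ ρ * (c ^ ρ * (q n : ℝ) ^ σ) := by field_simp
    _ ≤ _ := by gcongr

end IsFareyChain

/-! ### Upper bound for the partial sums -/

namespace IsFareyChain

variable {a b : ℝ} {K p q : ℕ → ℤ}

/-- A vector of a chain lies in a cone of a decreasing chain together with its successor. -/
theorem cone_of_strictAnti {K' P Q : ℕ → ℤ} (h : IsFareyChain a b K p q)
    (h' : IsFareyChain a b K' P Q) (hanti : StrictAnti fun n => latticeAbscissa a b (P n) (Q n))
    {n i : ℕ}
    (h1 : Q i / latticeAbscissa a b (P i) (Q i) ≤ q n / latticeAbscissa a b (p n) (q n))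
    (h2 : q n / latticeAbscissa a b (p n) (q n) <
      Q (i + 1) / latticeAbscissa a b (P (i + 1)) (Q (i + 1))) :
    ∃ α β γ δ : ℤ, 0 ≤ α ∧ 0 ≤ β ∧ 0 ≤ γ ∧ 0 ≤ δ ∧ α * δ - γ * β = 1 ∧
      α * P i + β * P (i + 1) = p n ∧ α * Q i + β * Q (i + 1) = q n ∧
      γ * P i + δ * P (i + 1) = p (n + 1) ∧ γ * Q i + δ * Q (i + 1) = q (n + 1) ∧
      α * latticeAbscissa a b (P i) (Q i) ≤ 1 ∧ γ * latticeAbscissa a b (P i) (Q i) ≤ 1 ∧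
      q (n + 1) / latticeAbscissa a b (p (n + 1)) (q (n + 1)) ≤
        Q (i + 1) / latticeAbscissa a b (P (i + 1)) (Q (i + 1)) := by
  obtain ⟨hβ, hα⟩ := h'.coeff_nonneg_pos (h.pos n) h1 h2
  have ep := h'.p_decomp i (p n) (q n)
  have eq := h'.q_decomp i (p n) (q n)
  have ex := h'.abscissa_decomp i (p n) (q n)
  have ep' := h'.p_decomp i (p (n + 1)) (q (n + 1))
  have eq' := h'.q_decomp i (p (n + 1)) (q (n + 1))
  have ex' := h'.abscissa_decomp i (p (n + 1)) (q (n + 1))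
  have hdet : (p n * Q (i + 1) - P (i + 1) * q n) * (P i * q (n + 1) - p (n + 1) * Q i) -
      (p (n + 1) * Q (i + 1) - P (i + 1) * q (n + 1)) * (P i * q n - p n * Q i) = 1 := by
    have e1 := h.det n
    have e2 := h'.det i
    linear_combination (P i * Q (i + 1) - P (i + 1) * Q i) * e1 + e2
  have hγ : (a : ℝ) * ((p (n + 1) * Q (i + 1) - P (i + 1) * q (n + 1) : ℤ) : ℝ) =
      Q (i + 1) * latticeAbscissa a b (p (n + 1)) (q (n + 1)) -
        q (n + 1) * latticeAbscissa a b (P (i + 1)) (Q (i + 1)) := by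
    simp only [latticeAbscissa]; push_cast; ring
  set α := p n * Q (i + 1) - P (i + 1) * q n
  set β := P i * q n - p n * Q i
  set γ := p (n + 1) * Q (i + 1) - P (i + 1) * q (n + 1)
  set δ := P i * q (n + 1) - p (n + 1) * Q i
  have hX := h'.pos i
  have hX' := h'.pos (i + 1)
  have hlt : latticeAbscissa a b (P (i + 1)) (Q (i + 1)) < latticeAbscissa a b (P i) (Q i) :=
    hanti (Nat.lt_succ_self i)
  -- If `γ ≤ -1`, the determinant forces `δ ≤ 1`, and the abscissa of the successor would be at most
  -- `X' - X < 0`: here the decreasing abscissae matter.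
  have hγ0 : 0 ≤ γ := by
    by_contra hcon
    have h3 : γ ≤ -1 := by omega
    have h4 : δ ≤ 1 := by nlinarith
    have h3' : (γ : ℝ) ≤ -1 := by exact_mod_cast h3
    have h4' : (δ : ℝ) ≤ 1 := by exact_mod_cast h4
    have := h.pos (n + 1)
    nlinarith
  have hδ0 : 0 ≤ δ := by
    by_contra hcon
    nlinarith
  have r1 : (0 : ℝ) ≤ β := by exact_mod_cast hβ
  have r2 : (0 : ℝ) ≤ δ := by exact_mod_cast hδ0
  have r3 : (0 : ℝ) ≤ γ := by exact_mod_cast hγ0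
  refine ⟨α, β, γ, δ, hα.le, hβ, hγ0, hδ0, hdet, ep, eq, ep', eq', ?_, ?_, ?_⟩
  · linarith [h.le_one n, mul_nonneg r1 hX'.le]
  · linarith [h.le_one (n + 1), mul_nonneg r2 hX'.le]
  · rw [div_le_div_iff₀ (h.pos _) hX']
    linarith [mul_nonneg h.a_pos.le r3]

theorem inv_abscissa_le_slope_rpow {C X Q ρ : ℝ} (hX : 0 < X) (hQ : 0 < Q)
    (h : (1 / X) ^ (1 - ρ) ≤ C * Q ^ ρ) : 1 / X ≤ C * (Q / X) ^ ρ := by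
  have hX' : 0 < 1 / X := by positivity
  calc 1 / X = (1 / X) ^ (1 - ρ) * (1 / X) ^ ρ := by
        rw [← Real.rpow_add hX', sub_add_cancel, Real.rpow_one]
    _ ≤ C * Q ^ ρ * (1 / X) ^ ρ := by gcongr
    _ = C * (Q / X) ^ ρ := by
        rw [mul_assoc, ← Real.mul_rpow hQ.le hX'.le, mul_one_div]

theorem le_mul_rpow_of_le_slope {C S X Q ρ : ℝ} (hX : 0 < X) (hQ : 0 < Q) (hS : 0 < S)
    (hρ1 : ρ ≤ 1) (hSQ : S ≤ Q / X) (h : (1 / X) ^ (1 - ρ) ≤ C * Q ^ ρ) :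
    S / Q ≤ C * S ^ ρ := by
  rw [div_le_iff₀ hQ]
  calc S = S ^ ρ * S ^ (1 - ρ) := by rw [← Real.rpow_add hS, add_sub_cancel, Real.rpow_one]
    _ ≤ S ^ ρ * (Q / X) ^ (1 - ρ) := by
        gcongr
    _ = S ^ ρ * (Q ^ (1 - ρ) * (1 / X) ^ (1 - ρ)) := by
        rw [← Real.mul_rpow hQ.le (by positivity), mul_one_div]
    _ ≤ S ^ ρ * (Q ^ (1 - ρ) * (C * Q ^ ρ)) := by gcongr
    _ = C * S ^ ρ * (Q ^ (1 - ρ) * Q ^ ρ) := by ring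
    _ = C * S ^ ρ * Q := by rw [← Real.rpow_add hQ, sub_add_cancel, Real.rpow_one]

/-- The sum is compared with that of the minus chain at the cone containing the pair. The
coordinates `α, γ` are at most `1 / X`, the coordinates `β, δ` at most `S / Q (i + 1)`, and the sum
of the minus chain is at most `1 / X + i` up to a constant; the approximation bounds turn each into
`S ^ ρ`. -/
theorem abs_sum_le_slope_rpow (h : IsFareyChain a b K p q) (hb : 0 < b)
    (hirr : Irrational (b / a)) {ρ : ℝ} (hρ : 0 < ρ) (hρ1 : ρ ≤ 1)
    (hup : UpperApproxBound a b ρ) (hlow : LowerApproxBound a b ρ) :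
    ∃ A B : ℝ, 0 < A ∧ 0 < B ∧ ∀ n : ℕ, |((∑ i ∈ Finset.range (n + 1), (K i - 3) : ℤ) : ℝ)| ≤
      A + B * (q (n + 1) / latticeAbscissa a b (p (n + 1)) (q (n + 1))) ^ ρ := by
  have ha := h.a_pos
  obtain ⟨K', P, Q, h', hanti⟩ := exists_isFareyChain_strictAnti ha h.a_le_one hirr
  obtain ⟨B₁, hB₁⟩ := h.sternBrocotWeight_eq hb
  obtain ⟨B₂, hB₂⟩ := h'.sternBrocotWeight_eq hb
  obtain ⟨C₁, hC₁, hup⟩ := hup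
  obtain ⟨C₂, hC₂, hcount⟩ := h'.natCast_le_slope_rpow hanti hρ hρ1 hlow
  have hC₁0 : 0 < C₁ := by linarith
  refine ⟨|(B₁ : ℝ)| + |(B₂ : ℝ)| + |(K' 0 : ℝ) - 3| + 3 / a, 3 * C₁ + C₂ + 2 * C₁,
    by positivity, by positivity, fun n => ?_⟩
  obtain ⟨i, h1, h2⟩ := h'.exists_slope_le_lt (S := q n / latticeAbscissa a b (p n) (q n))
    (div_nonneg (by exact_mod_cast h.q_nonneg n) (h.pos n).le)
  obtain ⟨α, β, γ, δ, hα, hβ, hγ, hδ, hdet, ep, eq, ep', eq', hαX, hγX, hS⟩ :=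
    h.cone_of_strictAnti h' hanti h1 h2
  have hmono := h.slope_add_le_slope_succ n
  set S := q (n + 1) / latticeAbscissa a b (p (n + 1)) (q (n + 1)) with hSdef
  set X := latticeAbscissa a b (P i) (Q i) with hXdef
  set X' := latticeAbscissa a b (P (i + 1)) (Q (i + 1)) with hXdef'
  have hX : 0 < X := h'.pos i
  have hX' : 0 < X' := h'.pos (i + 1)
  have hq' : (1 : ℝ) ≤ q (n + 1) := by exact_mod_cast h.q_pos (Nat.succ_pos n)
  have hS0 : 0 < S := div_pos (by linarith) (h.pos _)
  have hQ' : (1 : ℝ) ≤ Q (i + 1) := by exact_mod_cast h'.q_pos (Nat.succ_pos i)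
  have hqS : ∀ m, (q m : ℝ) ≤ q m / latticeAbscissa a b (p m) (q m) := fun m =>
    le_div_self (by exact_mod_cast h.q_nonneg m) (h.pos m) (h.le_one m)
  have hcone := abs_sternBrocotWeight_cone_sub_le (h'.p_pos hb i).le (h'.q_nonneg i)
    (h'.p_pos hb (i + 1)).le (h'.q_nonneg (i + 1))
    (add_pos_of_pos_of_nonneg (h'.p_pos hb i) (h'.q_nonneg i))
    (add_pos_of_pos_of_nonneg (h'.p_pos hb (i + 1)) (h'.q_nonneg (i + 1)))
    (α + β + γ + δ).toNat hα hβ hγ hδ hdet (Int.self_le_toNat _)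
  rw [ep, eq, ep', eq', hB₁, hB₂] at hcone
  have hcone' : |((∑ i ∈ Finset.range (n + 1), (K i - 3) : ℤ) : ℝ) + B₁ -
      (((∑ j ∈ Finset.range (i + 1), (K' j - 3) : ℤ) : ℝ) + B₂)| ≤ α + β + γ + δ - 2 := by
    exact_mod_cast hcone
  have hsum := h'.abs_sum_coeff_sub_three_le hanti i
  have r1 : (0 : ℝ) ≤ α := by exact_mod_cast hα
  have r2 : (0 : ℝ) ≤ β := by exact_mod_cast hβ
  have r3 : (0 : ℝ) ≤ γ := by exact_mod_cast hγ
  have r4 : (0 : ℝ) ≤ δ := by exact_mod_cast hδ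
  have rQ : (0 : ℝ) ≤ Q i := by exact_mod_cast h'.q_nonneg i
  have hα' : (α : ℝ) ≤ 1 / X := by rwa [le_div_iff₀ hX]
  have hγ' : (γ : ℝ) ≤ 1 / X := by rwa [le_div_iff₀ hX]
  have eqr : (α : ℝ) * Q i + β * Q (i + 1) = q n := by exact_mod_cast eq
  have eqr' : (γ : ℝ) * Q i + δ * Q (i + 1) = q (n + 1) := by exact_mod_cast eq'
  have hβ' : (β : ℝ) ≤ S / Q (i + 1) := by
    rw [le_div_iff₀ (by linarith)]
    linarith [hqS n, mul_nonneg r1 rQ]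
  have hδ' : (δ : ℝ) ≤ S / Q (i + 1) := by
    rw [le_div_iff₀ (by linarith)]
    linarith [hqS (n + 1), mul_nonneg r3 rQ]
  have hSQ : S / Q (i + 1) ≤ C₁ * S ^ ρ :=
    le_mul_rpow_of_le_slope hX' (by linarith) hS0 hρ1 hS
      (hup _ _ (h'.isCoprime _) (h'.q_pos (Nat.succ_pos i)) hX')
  have hSρ : 0 < S ^ ρ := Real.rpow_pos_of_pos hS0 ρ
  -- Two terms `1 / X` come from `α` and `γ`, the third from the minus chain. At `i = 0` the
  -- denominator is `0` and the approximation bound does not apply; there `X = a`.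
  have hXi : 3 * (1 / X) + i ≤ 3 / a + (3 * C₁ + C₂) * S ^ ρ := by
    rcases Nat.eq_zero_or_pos i with rfl | hi
    · have : X = a := h'.abscissa_zero
      rw [this]
      have : 0 < (3 * C₁ + C₂) * S ^ ρ := by positivity
      push_cast
      rw [mul_one_div]
      linarith
    · have hQ1 : (1 : ℝ) ≤ Q i := by exact_mod_cast h'.q_pos hi
      have hmonoS : (Q i / X) ^ ρ ≤ S ^ ρ :=
        Real.rpow_le_rpow (by positivity) (by linarith) hρ.le
      have e1 := inv_abscissa_le_slope_rpow hX (by linarith : (0 : ℝ) < Q i)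
        (hup _ _ (h'.isCoprime _) (h'.q_pos hi) hX)
      have e2 := hcount i hi
      have e3 := mul_le_mul_of_nonneg_left hmonoS hC₁0.le
      have e4 := mul_le_mul_of_nonneg_left hmonoS hC₂.le
      have : 0 < 3 / a := by positivity
      linarith
  have t1 := neg_abs_le (B₁ : ℝ)
  have t2 := le_abs_self (B₁ : ℝ)
  have t3 := neg_abs_le (B₂ : ℝ)
  have t4 := le_abs_self (B₂ : ℝ)
  rw [abs_le] at hcone' hsum ⊢
  constructor <;> linarith

/-- The polynomial upper bound for the partial sums of the coefficients. -/
theorem abs_sum_le_rpow (h : IsFareyChain a b K p q)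
    (hsum : ∀ n, 1 < latticeAbscissa a b (p n) (q n) + latticeAbscissa a b (p (n + 1)) (q (n + 1)))
    (hb : 0 < b) (hirr : Irrational (b / a)) {ρ : ℝ} (hρ : 0 < ρ) (hρ1 : ρ ≤ 1)
    (hup : UpperApproxBound a b ρ) (hlow : LowerApproxBound a b ρ) :
    ∃ C : ℝ, 0 < C ∧ ∀ n : ℕ, 1 ≤ n →
      |((∑ i ∈ Finset.range (n + 1), (K i - 3) : ℤ) : ℝ)| ≤ C * (n : ℝ) ^ ρ := by
  obtain ⟨A, B, hA, hB, hAB⟩ := h.abs_sum_le_slope_rpow hb hirr hρ hρ1 hup hlow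
  obtain ⟨C, hC, hslope⟩ := h.slope_le hsum
  refine ⟨A + B * (3 * C) ^ ρ, by positivity, fun n hn => (hAB n).trans ?_⟩
  have hn' : (1 : ℝ) ≤ n := by exact_mod_cast hn
  have h1 : (1 : ℝ) ≤ (n : ℝ) ^ ρ := Real.one_le_rpow hn' hρ.le
  have h2 := hslope (n + 1)
  have h3 : (0 : ℝ) ≤ q (n + 1) / latticeAbscissa a b (p (n + 1)) (q (n + 1)) :=
    div_nonneg (by exact_mod_cast h.q_nonneg _) (h.pos _).le
  have h4 : (q (n + 1) / latticeAbscissa a b (p (n + 1)) (q (n + 1))) ^ ρ ≤ (3 * C * n) ^ ρ := by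
    refine Real.rpow_le_rpow h3 (h2.trans ?_) hρ.le
    push_cast
    nlinarith
  rw [Real.mul_rpow (by positivity) (by positivity)] at h4
  calc A + B * (q (n + 1) / latticeAbscissa a b (p (n + 1)) (q (n + 1))) ^ ρ
      ≤ A * (n : ℝ) ^ ρ + B * ((3 * C) ^ ρ * (n : ℝ) ^ ρ) := by
        gcongr
        exact le_mul_of_one_le_right hA.le h1
    _ = _ := by ring

end IsFareyChain

/-! ### Large partial sums from good approximants -/

namespace IsFareyChain

variable {a b : ℝ} {K p q : ℕ → ℤ}

/-- The vector occurs in the chain, and both its neighbours have abscissa above `1 - x`, so its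
coefficient is at least `2 / x - 2`. The partial sums before and after it differ by this coefficient
minus `3`, so one of them is large. -/
theorem exists_large_sum_of_upper (h : IsFareyChain a b K p q)
    (hsum : ∀ n, 1 < latticeAbscissa a b (p n) (q n) + latticeAbscissa a b (p (n + 1)) (q (n + 1)))
    {r s : ℤ} (hrs : IsCoprime r s) (hs : 1 ≤ s) (hx : 0 < latticeAbscissa a b r s)
    (hx1 : latticeAbscissa a b r s ≤ 1) :
    ∃ n : ℕ, 1 / latticeAbscissa a b r s - 3 ≤
        |((∑ i ∈ Finset.range (n + 1), (K i - 3) : ℤ) : ℝ)| ∧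
      a * n ≤ s / latticeAbscissa a b r s := by
  obtain ⟨m, rfl, rfl⟩ := h.exists_eq hsum hrs (by omega) hx hx1
  obtain ⟨m, rfl⟩ : ∃ k, m = k + 1 := by
    refine Nat.exists_eq_succ_of_ne_zero ?_
    rintro rfl
    rw [h.q_zero] at hs
    omega
  have h1 := h.abscissa_add_two m
  have h2 := hsum m
  have h3 := hsum (m + 1)
  have hslope := h.mul_le_slope (m + 1)
  have e : ((∑ i ∈ Finset.range (m + 1 + 1), (K i - 3) : ℤ) : ℝ) =
      ((∑ i ∈ Finset.range (m + 1), (K i - 3) : ℤ) : ℝ) + (K (m + 1) - 3) := by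
    rw [Finset.sum_range_succ]; push_cast; ring
  set x := latticeAbscissa a b (p (m + 1)) (q (m + 1))
  have hK : 2 * (1 / x) - 2 ≤ (K (m + 1) : ℝ) := by
    have : 2 * (1 / x) - 2 = (2 - 2 * x) / x := by field_simp
    rw [this, div_le_iff₀ hx]
    linarith
  rcases le_or_gt (1 / x - 3) |((∑ i ∈ Finset.range (m + 1), (K i - 3) : ℤ) : ℝ)| with h4 | h4
  · refine ⟨m, h4, le_trans ?_ hslope⟩
    push_cast
    linarith [h.a_pos]
  · refine ⟨m + 1, ?_, hslope⟩
    rw [e]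
    have h5 := le_abs_self
      (((∑ i ∈ Finset.range (m + 1), (K i - 3) : ℤ) : ℝ) + (K (m + 1) - 3))
    have h6 := neg_abs_le ((∑ i ∈ Finset.range (m + 1), (K i - 3) : ℤ) : ℝ)
    linarith

/-- The mean of the Stern–Brocot weights before and after a vector `(u, v)` that is the upper
neighbour of a vector `(r, s)` close to the line. -/
theorem exists_abs_sternBrocotWeight_add_sub_le (h : IsFareyChain a b K p q)
    (hsum : ∀ n, 1 < latticeAbscissa a b (p n) (q n) + latticeAbscissa a b (p (n + 1)) (q (n + 1)))
    (hb : 0 < b) {u v r s : ℤ} (hdet : u * s - r * v = 1) (hr : 0 ≤ r) (hs : 1 ≤ s)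
    (hu : r ≤ u) (hv : s ≤ v) (hx : 0 < latticeAbscissa a b u v)
    (hξ : latticeAbscissa a b r s < 0)
    (hx1 : latticeAbscissa a b u v - latticeAbscissa a b r s ≤ 1)
    (hξx : -(2 * latticeAbscissa a b r s) ≤ latticeAbscissa a b u v) :
    ∃ m, p (m + 1) = u ∧ q (m + 1) = v ∧
      |sternBrocotWeight (p m) (q m) (p (m + 1)) (q (m + 1)) +
        sternBrocotWeight (p (m + 1)) (q (m + 1)) (p (m + 2)) (q (m + 2)) -
        (2 * sternBrocotWeight u v r s + 3)| ≤ 1 := by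
  obtain ⟨m, rfl, rfl⟩ := h.exists_eq hsum (r := u) (s := v) ⟨s, -r, by linarith⟩ (by omega) hx
    (by linarith)
  obtain ⟨m, rfl⟩ : ∃ k, m = k + 1 := by
    refine Nat.exists_eq_succ_of_ne_zero ?_
    rintro rfl
    rw [h.q_zero] at hv
    omega
  refine ⟨m, rfl, rfl, ?_⟩
  have hd1 := h.det m
  have hd2 := h.det (m + 1)
  have s1 := hsum m
  have s2 := hsum (m + 1)
  have l1 := h.le_one m
  have l2 := h.le_one (m + 2)
  have hp1 := h.p_pos hb (m + 1)
  have hq1 := h.q_nonneg (m + 1)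
  set u := p (m + 1)
  set v := q (m + 1)
  obtain ⟨e, he⟩ : ∃ e, e = p (m + 2) * s - r * q (m + 2) := ⟨_, rfl⟩
  obtain ⟨e', he'⟩ : ∃ e', e' = p m * s - r * q m - 1 := ⟨_, rfl⟩
  -- By unimodularity the next vector is `(r, s) + e (u, v)` and the previous one is `(u - r, v - s)
  -- + e' (u, v)`.
  have ep : p (m + 2) = r + e * u := by
    rw [he]; linear_combination r * hd2 - p (m + 2) * hdet
  have eq : q (m + 2) = s + e * v := by
    rw [he]; linear_combination s * hd2 - q (m + 2) * hdet
  have ep' : p m = (u - r) + e' * u := by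
    rw [he']; linear_combination -r * hd1 - p m * hdet
  have eq' : q m = (v - s) + e' * v := by
    rw [he']; linear_combination -s * hd1 - q m * hdet
  have ex : latticeAbscissa a b (p (m + 2)) (q (m + 2)) =
      latticeAbscissa a b r s + e * latticeAbscissa a b u v := by
    rw [ep, eq]; simp only [latticeAbscissa]; push_cast; ring
  have ex' : latticeAbscissa a b (p m) (q m) =
      latticeAbscissa a b u v - latticeAbscissa a b r s + e' * latticeAbscissa a b u v := by
    rw [ep', eq']; simp only [latticeAbscissa]; push_cast; ring
  have he0 : 0 ≤ e := by
    by_contra hcon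
    have h1 : e ≤ -1 := by omega
    have h2 : (e : ℝ) ≤ -1 := by exact_mod_cast h1
    nlinarith
  have he0' : 0 ≤ e' := by
    by_contra hcon
    have h1 : e' ≤ -1 := by omega
    have h2 : (e' : ℝ) ≤ -1 := by exact_mod_cast h1
    nlinarith
  -- Both neighbours have abscissa in `(1 - x, 1]`, where `x` is the abscissa of `(u, v)`, so these
  -- differ by less than `x`; the offset from `(r, s)` is at most `x` by `hξx`. The weights depend
  -- on `e` and `-e'`, so the two large numbers nearly cancel in the sum.
  have hdiff : |e - e' - 1| ≤ 1 := by
    have h1 : ((e - e' - 1 : ℤ) : ℝ) < 2 := by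
      push_cast
      by_contra! hcon
      have := mul_le_mul_of_nonneg_right hcon hx.le
      linarith
    have h2 : (-2 : ℝ) < ((e - e' - 1 : ℤ) : ℝ) := by
      push_cast
      by_contra! hcon
      have := mul_le_mul_of_nonneg_right hcon hx.le
      linarith
    have h1' : e - e' - 1 < 2 := by exact_mod_cast h1
    have h2' : -2 < e - e' - 1 := by exact_mod_cast h2
    rw [abs_le]
    omega
  have hw : 0 < u - r + (v - s) :=
    (pos_add_of_det_eq_one (p := u - r) (q := v - s) (p' := r) (q' := s) (by omega) (by omega) hr
      (by omega) (by linarith)).1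
  have d1 := sternBrocotWeight_add_mul_right (p := u) (q := v) (p' := r) (q' := s) hp1.le hq1 hr
    (by omega) (by omega) (by omega) e.toNat
  have d2 := sternBrocotWeight_add_mul_left (p := u - r) (q := v - s) (p' := u) (q' := v)
    (by omega) (by omega) hp1.le hq1 (by omega) e'.toNat
  have d3 := sternBrocotWeight_add_left (p := u - r) (q := v - s) (p' := r) (q' := s)
    (by omega) (by omega) hr (by omega) (by omega)
  have d4 := sternBrocotWeight_add_right (p := u - r) (q := v - s) (p' := r) (q' := s)
    (by omega) (by omega) hr (by omega) hw (by omega)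
  rw [Int.toNat_of_nonneg he0, ← ep, ← eq] at d1
  rw [Int.toNat_of_nonneg he0', ← ep', ← eq'] at d2
  rw [sub_add_cancel, sub_add_cancel] at d3 d4
  rw [d1, d2, d4]
  rw [abs_le] at hdiff ⊢
  constructor <;> linarith

/-- The vectors `(u₀, v₀) + j (r, s)` with `(u₀, v₀)` an upper neighbour of `(r, s)` stay in the
strip for `j ≤ J + 2`. The mean weight around such a vector falls by one with each `j`, up to a
bounded error, so the sums near the two ends of the progression cannot all be small. -/
theorem exists_large_sum_of_lower (h : IsFareyChain a b K p q)
    (hsum : ∀ n, 1 < latticeAbscissa a b (p n) (q n) + latticeAbscissa a b (p (n + 1)) (q (n + 1)))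
    (hb : 0 < b) {r s : ℤ} (hrs : IsCoprime r s) (hs : 1 ≤ s)
    (hξ : latticeAbscissa a b r s < 0) {J : ℕ}
    (hJ : 2 * -latticeAbscissa a b r s * ((J + 3) * s) ≤ a) :
    ∃ n : ℕ, ((J : ℝ) - 1) / 2 ≤ |((∑ i ∈ Finset.range (n + 1), (K i - 3) : ℤ) : ℝ)| ∧
      n * (a * -latticeAbscissa a b r s) ≤ s := by
  have ha := h.a_pos
  have ha1 := h.a_le_one
  have hs' : (1 : ℝ) ≤ s := by exact_mod_cast hs
  have hJ0 : (0 : ℝ) ≤ J := J.cast_nonneg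
  obtain ⟨ξ, hξdef⟩ : ∃ ξ, ξ = -latticeAbscissa a b r s := ⟨_, rfl⟩
  have hξ0 : 0 < ξ := by linarith
  have hr : 0 ≤ r := by
    by_contra hcon
    have h1 : (r : ℝ) ≤ -1 := by exact_mod_cast (by omega : r ≤ -1)
    have h2 : a ≤ ξ := by
      rw [hξdef]
      unfold latticeAbscissa
      nlinarith
    rw [← hξdef] at hJ
    have h3 : 3 ≤ (J + 3) * (s : ℝ) := by nlinarith
    nlinarith
  obtain ⟨x, y, hxy⟩ := hrs
  -- The Bézout solution is normalised to `0 ≤ v₀ < s`.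
  obtain ⟨v₀, hv₀⟩ : ∃ v₀, v₀ = (-x) % s := ⟨_, rfl⟩
  obtain ⟨u₀, hu₀⟩ : ∃ u₀, u₀ = y - r * ((-x) / s) := ⟨_, rfl⟩
  have hv0 : 0 ≤ v₀ := hv₀ ▸ Int.emod_nonneg _ (by omega)
  have hv1 : v₀ < s := hv₀ ▸ Int.emod_lt_of_pos _ (by omega)
  have hdet : u₀ * s - r * v₀ = 1 := by
    have := Int.emod_add_mul_ediv (-x) s
    rw [← hv₀] at this
    rw [hu₀]
    linear_combination hxy + r * this * (-1)
  have hu0 : 0 ≤ u₀ := by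
    by_contra hcon
    nlinarith [mul_nonneg hr hv0]
  have hW := sternBrocotWeight_add_mul_left hu0 hv0 hr (by omega : 0 ≤ s)
    (by omega : 0 < r + s)
  have hx : ∀ j : ℕ, latticeAbscissa a b (u₀ + j * r) (v₀ + j * s) * s + ξ * (v₀ + j * s) = a := by
    intro j
    have := congrArg (fun z : ℤ => (z : ℝ)) hdet
    push_cast at this
    rw [hξdef]
    simp only [latticeAbscissa]
    push_cast
    linear_combination a * this
  have hv' : ∀ j : ℕ, j ≤ J + 2 → ξ * (v₀ + j * s) ≤ a / 2 := by
    intro j hj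
    have h1 : (j : ℝ) ≤ J + 2 := by exact_mod_cast hj
    have h2 : (v₀ : ℝ) ≤ s := by exact_mod_cast hv1.le
    have h3 : (v₀ + j * s : ℝ) ≤ (J + 3) * s := by nlinarith
    rw [← hξdef] at hJ
    nlinarith
  have hlow : ∀ j : ℕ, j ≤ J + 2 →
      a / 2 ≤ latticeAbscissa a b (u₀ + j * r) (v₀ + j * s) * s := by
    intro j hj
    linarith [hx j, hv' j hj]
  have hv0' : (0 : ℝ) ≤ v₀ := by exact_mod_cast hv0
  have hle : ∀ j : ℕ, latticeAbscissa a b (u₀ + j * r) (v₀ + j * s) ≤ 1 := by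
    intro j
    have h1 : 0 ≤ ξ * (v₀ + j * s) := by positivity
    have h2 := hx j
    by_contra! hcon
    nlinarith
  have hlocal : ∀ j : ℕ, j ≤ J → ∃ m : ℕ, a * ((m + 1) * ξ) ≤ s ∧
      |sternBrocotWeight (p m) (q m) (p (m + 1)) (q (m + 1)) +
        sternBrocotWeight (p (m + 1)) (q (m + 1)) (p (m + 2)) (q (m + 2)) -
        (2 * (sternBrocotWeight u₀ v₀ r s - (j + 1)) + 3)| ≤ 1 := by
    intro j hj
    have hl := hlow (j + 1) (by omega)
    have hl' := hle j
    have hv'' := hv' (j + 1) (by omega)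
    have hxj : 0 < latticeAbscissa a b (u₀ + (j + 1 : ℕ) * r) (v₀ + (j + 1 : ℕ) * s) :=
      pos_of_mul_pos_left (by linarith) (by linarith : (0 : ℝ) ≤ s)
    have esub : latticeAbscissa a b (u₀ + j * r) (v₀ + j * s) =
        latticeAbscissa a b (u₀ + (j + 1 : ℕ) * r) (v₀ + (j + 1 : ℕ) * s) -
          latticeAbscissa a b r s := by
      simp only [latticeAbscissa]; push_cast; ring
    have hjr : 0 ≤ (j : ℤ) * r := by positivity
    have hjs : 0 ≤ (j : ℤ) * s := by positivity
    obtain ⟨m, hm1, hm2, hm⟩ := h.exists_abs_sternBrocotWeight_add_sub_le hsum hb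
      (u := u₀ + (j + 1 : ℕ) * r) (v := v₀ + (j + 1 : ℕ) * s) (r := r) (s := s)
      (by linear_combination hdet) hr hs (by push_cast; linarith) (by push_cast; linarith) hxj hξ
      (by linarith) (by
        rw [← hξdef] at hJ
        have h3 : ξ * (3 * s) ≤ ξ * ((J + 3) * s) := by gcongr; linarith
        have h4 : 2 * ξ * s ≤ latticeAbscissa a b (u₀ + (j + 1 : ℕ) * r) (v₀ + (j + 1 : ℕ) * s) * s := by
          nlinarith
        have := le_of_mul_le_mul_right h4 (by linarith)
        linarith)
    rw [hW] at hm
    refine ⟨m, ?_, by push_cast at hm; exact hm⟩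
    have hslope := h.mul_le_slope (m + 1)
    rw [hm1, hm2, le_div_iff₀ hxj] at hslope
    set X := latticeAbscissa a b (u₀ + (j + 1 : ℕ) * r) (v₀ + (j + 1 : ℕ) * s)
    push_cast at hslope hv''
    have hm0 : (0 : ℝ) ≤ a * ((m + 1) * ξ) := by positivity
    have h5 : a * ((m + 1) * ξ) * (X * s) ≤ a / 2 * s := by
      calc a * ((m + 1) * ξ) * (X * s) = (a * (m + 1) * X) * (ξ * s) := by ring
        _ ≤ (v₀ + (j + 1) * s) * (ξ * s) := by gcongr
        _ = ξ * (v₀ + (j + 1) * s) * s := by ring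
        _ ≤ a / 2 * s := by gcongr
    have h6 : a * ((m + 1) * ξ) * (a / 2) ≤ s * (a / 2) := by
      calc a * ((m + 1) * ξ) * (a / 2) ≤ a * ((m + 1) * ξ) * (X * s) := by gcongr
        _ ≤ _ := by linarith
    exact le_of_mul_le_mul_right h6 (by positivity)
  obtain ⟨B, hB⟩ := h.sternBrocotWeight_eq hb
  obtain ⟨m₁, hm₁, hw₁⟩ := hlocal 0 (Nat.zero_le _)
  obtain ⟨m₂, hm₂, hw₂⟩ := hlocal J le_rfl
  rw [hB, hB] at hw₁ hw₂
  -- The two pair sums differ by `2 * J` with an error of at most `1` each; four sums below `(J - 1)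
  -- / 2` in absolute value would contradict this.
  have key : (2 * J - 2 : ℤ) ≤
      (∑ i ∈ Finset.range (m₁ + 1), (K i - 3)) + (∑ i ∈ Finset.range (m₁ + 1 + 1), (K i - 3)) -
      (∑ i ∈ Finset.range (m₂ + 1), (K i - 3)) - (∑ i ∈ Finset.range (m₂ + 1 + 1), (K i - 3)) := by
    rw [abs_le] at hw₁ hw₂
    push_cast at hw₁
    linarith
  have key' : (2 * J - 2 : ℝ) ≤
      ((∑ i ∈ Finset.range (m₁ + 1), (K i - 3) : ℤ) : ℝ) +
        ((∑ i ∈ Finset.range (m₁ + 1 + 1), (K i - 3) : ℤ) : ℝ) -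
      ((∑ i ∈ Finset.range (m₂ + 1), (K i - 3) : ℤ) : ℝ) -
        ((∑ i ∈ Finset.range (m₂ + 1 + 1), (K i - 3) : ℤ) : ℝ) := by
    exact_mod_cast key
  rw [← hξdef]
  by_contra! hcon
  have haξ : 0 < a * ξ := by positivity
  have c : ∀ n : ℕ, n * (a * ξ) ≤ s →
      |((∑ i ∈ Finset.range (n + 1), (K i - 3) : ℤ) : ℝ)| < ((J : ℝ) - 1) / 2 := by
    intro n hn
    by_contra! h1
    exact absurd hn (not_le.2 (hcon n h1))
  have c1 := c m₁ (by linarith)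
  have c2 := c (m₁ + 1) (by push_cast; linarith)
  have c3 := c m₂ (by linarith)
  have c4 := c (m₂ + 1) (by push_cast; linarith)
  rw [abs_lt] at c1 c2 c3 c4
  linarith

end IsFareyChain

/-! ### Diophantine exponents and approximation bounds -/

/-- The rationals that approximate `s` from above with exponent `v`. -/
def upperApproximants (s v : ℝ) : Set ℚ :=
  {r : ℚ | 0 < (r : ℝ) - s ∧ (r : ℝ) - s < 1 / (r.den : ℝ) ^ v}

theorem upperApproximants_anti (s : ℝ) : Antitone (upperApproximants s) := by
  intro v w hvw r hr
  refine ⟨hr.1, hr.2.trans_le ?_⟩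
  have : (1 : ℝ) ≤ r.den := by exact_mod_cast r.pos
  gcongr

theorem oddDiophantineExponent_eq (s : ℝ) :
    oddDiophantineExponent s = evenDiophantineExponent (-s) := by
  unfold oddDiophantineExponent evenDiophantineExponent
  congr 2
  ext v
  simp only [Set.mem_ofPred_eq]
  have : {r : ℚ | 0 < s - (r : ℝ) ∧ s - (r : ℝ) < 1 / (r.den : ℝ) ^ v} =
      Neg.neg ⁻¹' {r : ℚ | 0 < (r : ℝ) - -s ∧ (r : ℝ) - -s < 1 / (r.den : ℝ) ^ v} := by
    ext r
    simp only [Set.mem_ofPred_eq, Set.mem_preimage, Rat.cast_neg, Rat.den_neg_eq_den]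
    rw [show -(r : ℝ) - -s = s - r by ring]
  rw [this]
  refine ⟨fun h hfin => h (hfin.preimage neg_injective.injOn), fun h hfin => h ?_⟩
  refine (hfin.image Neg.neg).subset fun r hr => ⟨-r, ?_, neg_neg r⟩
  rwa [Set.mem_preimage, neg_neg]

theorem upperApproximants_infinite_of_lt {s v : ℝ}
    (h : (v : EReal) < evenDiophantineExponent s) : (upperApproximants s v).Infinite := by
  obtain ⟨_, ⟨w, hw, rfl⟩, hvw⟩ := lt_sSup_iff.1 h
  exact Set.Infinite.mono (upperApproximants_anti s (EReal.coe_lt_coe_iff.1 hvw).le) hw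

theorem upperApproximants_finite_of_gt {s v : ℝ}
    (h : evenDiophantineExponent s < (v : EReal)) : (upperApproximants s v).Finite := by
  by_contra hcon
  exact absurd h (not_lt.2 (le_sSup ⟨v, hcon, rfl⟩))

theorem exists_pos_le_of_finite {F : Set ℚ} (hF : F.Finite) {g : ℚ → ℝ} (hg : ∀ r ∈ F, 0 < g r) :
    ∃ c : ℝ, 0 < c ∧ ∀ r ∈ F, c ≤ g r := by
  rcases F.eq_empty_or_nonempty with rfl | hne
  · exact ⟨1, one_pos, by simp⟩
  · obtain ⟨r₀, hr₀, hmin⟩ := Set.exists_min_image F g hF hne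
    exact ⟨g r₀, hg r₀ hr₀, hmin⟩

/-- Finitely many approximants would stay at a positive distance from `s`, but `(⌊n * s⌋ + 1) / n`
is within `1 / n`. The bound `1`, weaker than Dirichlet's `2`, suffices: it makes the division by
the exponent harmless and the even ratio nonnegative. -/
theorem one_le_evenDiophantineExponent {s : ℝ} (hs : Irrational s) :
    1 ≤ evenDiophantineExponent s := by
  refine le_sSup ⟨1, ?_, rfl⟩
  intro hfin
  obtain ⟨c, hc, hle⟩ := exists_pos_le_of_finite hfin (g := fun r => (r : ℝ) - s) fun r hr => hr.1
  obtain ⟨n, hn⟩ := exists_nat_gt (1 / c)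
  have hn0 : (0 : ℝ) < n := lt_trans (by positivity) hn
  have hn0' : 0 < n := by exact_mod_cast hn0
  have hnc : 1 / (n : ℝ) < c := by
    rw [div_lt_iff₀ hc] at hn
    rw [div_lt_iff₀ hn0]
    linarith
  have hfl : (⌊n * s⌋ : ℝ) < n * s :=
    lt_of_le_of_ne (Int.floor_le _) fun h =>
      (hs.natCast_mul hn0'.ne').ne_int _ h.symm
  have hfl' := Int.lt_floor_add_one (n * s)
  set r : ℚ := Rat.divInt (⌊n * s⌋ + 1) n with hr
  have hrr : (r : ℝ) - s = (⌊n * s⌋ + 1 - n * s) / n := by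
    rw [hr, Rat.divInt_eq_div]
    push_cast
    field_simp
  have h1 : 0 < (r : ℝ) - s := by
    rw [hrr]
    exact div_pos (by linarith) hn0
  have h2 : (r : ℝ) - s < 1 / n := by
    rw [hrr]
    exact div_lt_div_of_pos_right (by linarith) hn0
  have hden : r.den ≤ n := Nat.le_of_dvd hn0' (by
    have := Rat.den_dvd (⌊n * s⌋ + 1) n
    exact_mod_cast this)
  have hden' : (r.den : ℝ) ≤ n := by exact_mod_cast hden
  have hden0 : (0 : ℝ) < r.den := by exact_mod_cast r.pos
  have := hle r ⟨h1, h2.trans_le (by rw [Real.rpow_one]; gcongr)⟩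
  linarith

theorem exists_mul_le_of_upperApproximants_finite {s v : ℝ} (hv : 0 ≤ v)
    (h : (upperApproximants s v).Finite) :
    ∃ c : ℝ, 0 < c ∧ c ≤ 1 ∧ ∀ r : ℚ, 0 < (r : ℝ) - s → c / (r.den : ℝ) ^ v ≤ r - s := by
  obtain ⟨c, hc, hle⟩ := exists_pos_le_of_finite h (g := fun r => (r : ℝ) - s) fun r hr => hr.1
  refine ⟨min c 1, lt_min hc one_pos, min_le_right _ _, fun r hr => ?_⟩
  have hden : (1 : ℝ) ≤ r.den := by exact_mod_cast r.pos
  have hpow : 1 ≤ (r.den : ℝ) ^ v := Real.one_le_rpow hden hv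
  by_cases hmem : r ∈ upperApproximants s v
  · calc min c 1 / (r.den : ℝ) ^ v ≤ min c 1 := div_le_self (lt_min hc one_pos).le hpow
      _ ≤ c := min_le_left _ _
      _ ≤ r - s := hle r hmem
  · have : 1 / (r.den : ℝ) ^ v ≤ r - s := by
      by_contra! hcon
      exact hmem ⟨hr, hcon⟩
    refine le_trans ?_ this
    gcongr
    exact min_le_right _ _

theorem latticeAbscissa_eq {a : ℝ} (ha : 0 < a) (b : ℝ) (p : ℤ) {q : ℤ} (hq : 1 ≤ q) :
    latticeAbscissa a b p q = a * q * (((p / q : ℚ) : ℝ) - b / a) := by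
  have : (0 : ℝ) < q := by exact_mod_cast (by omega : 0 < q)
  unfold latticeAbscissa
  push_cast
  field_simp

theorem exists_rpow_le_of_finite {a b v ρ : ℝ} (ha : 0 < a) (ha1 : a ≤ 1) (hv : 0 ≤ v) (hρ : ρ ≤ 1)
    (h : (upperApproximants (b / a) v).Finite) :
    ∃ C : ℝ, 1 ≤ C ∧ ∀ p q : ℤ, IsCoprime p q → 1 ≤ q → 0 < latticeAbscissa a b p q →
      (1 / latticeAbscissa a b p q) ^ (1 - ρ) ≤ C * (q : ℝ) ^ ((v - 1) * (1 - ρ)) := by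
  obtain ⟨c, hc, hc1, hle⟩ := exists_mul_le_of_upperApproximants_finite hv h
  have hac : 1 ≤ 1 / (a * c) := by
    rw [le_div_iff₀ (by positivity)]
    nlinarith
  refine ⟨(1 / (a * c)) ^ (1 - ρ), Real.one_le_rpow hac (by linarith), fun p q hpq hq hx => ?_⟩
  have hq0 : (0 : ℝ) < q := by exact_mod_cast (by omega : 0 < q)
  have hden : (((p / q : ℚ).den : ℤ) : ℝ) = q := by
    rw [Rat.den_div_eq_of_coprime (by omega) (Int.isCoprime_iff_nat_coprime.1 hpq)]
  rw [Int.cast_natCast] at hden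
  have e := latticeAbscissa_eq ha b p hq
  have hr := hle (p / q : ℚ) (by
    rw [e] at hx
    exact pos_of_mul_pos_right hx (by positivity))
  rw [hden] at hr
  have h1 : 1 / latticeAbscissa a b p q ≤ 1 / (a * c) * (q : ℝ) ^ (v - 1) := by
    rw [div_le_iff₀ hx, e]
    have h2 : (q : ℝ) ^ (v - 1) * q = (q : ℝ) ^ v := by
      conv_lhs => rw [← Real.rpow_add_one hq0.ne', sub_add_cancel]
    have h3 : 0 < (q : ℝ) ^ v := by positivity
    rw [div_le_iff₀ h3] at hr
    calc (1 : ℝ) = 1 / c * c := by field_simp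
      _ ≤ 1 / c * ((((p / q : ℚ) : ℝ) - b / a) * (q : ℝ) ^ v) := by gcongr
      _ = 1 / (a * c) * (q : ℝ) ^ (v - 1) * (a * q * (((p / q : ℚ) : ℝ) - b / a)) := by
        rw [← h2]; field_simp
  calc (1 / latticeAbscissa a b p q) ^ (1 - ρ)
      ≤ (1 / (a * c) * (q : ℝ) ^ (v - 1)) ^ (1 - ρ) :=
        Real.rpow_le_rpow (by positivity) h1 (by linarith)
    _ = _ := by
        rw [Real.mul_rpow (by positivity) (by positivity), ← Real.rpow_mul hq0.le]

theorem upperApproxBound_one (a b : ℝ) : UpperApproxBound a b 1 := by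
  refine ⟨1, le_rfl, fun p q _ hq _ => ?_⟩
  have : (1 : ℝ) ≤ q := by exact_mod_cast hq
  simpa using this

theorem lowerApproxBound_one (a b : ℝ) : LowerApproxBound a b 1 := by
  refine ⟨1, le_rfl, fun p q _ hq _ => ?_⟩
  have : (1 : ℝ) ≤ q := by exact_mod_cast hq
  rw [sub_self, Real.rpow_zero, one_mul]
  exact Real.one_le_rpow this (by norm_num)

theorem upperApproxBound_of_lt {a b ρ : ℝ} (ha : 0 < a) (ha1 : a ≤ 1) (hρ : ρ < 1)
    (h : evenDiophantineExponent (b / a) < ((1 / (1 - ρ) : ℝ) : EReal)) :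
    UpperApproxBound a b ρ := by
  have h1 : 0 < 1 - ρ := by linarith
  obtain ⟨C, hC, hle⟩ := exists_rpow_le_of_finite ha ha1 (by positivity) hρ.le
    (upperApproximants_finite_of_gt h)
  refine ⟨C, hC, fun p q hpq hq hx => ?_⟩
  have := hle p q hpq hq hx
  -- The abscissa is `a * q` times the distance from `p / q` to `b / a`, which shifts the exponent
  -- `v` to `v - 1`.
  rwa [show (1 / (1 - ρ) - 1) * (1 - ρ) = ρ by field_simp; ring] at this

theorem lowerApproxBound_of_lt {a b ρ : ℝ} (ha : 0 < a) (ha1 : a ≤ 1) (hρ : ρ < 1)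
    (h : oddDiophantineExponent (b / a) < ((2 / (1 - ρ) : ℝ) : EReal)) :
    LowerApproxBound a b ρ := by
  have h1 : 0 < 1 - ρ := by linarith
  rw [oddDiophantineExponent_eq, ← neg_div] at h
  obtain ⟨C, hC, hle⟩ := exists_rpow_le_of_finite ha ha1 (by positivity) hρ.le
    (upperApproximants_finite_of_gt h)
  refine ⟨C, hC, fun p q hpq hq hx => ?_⟩
  have e : latticeAbscissa a (-b) (-p) q = -latticeAbscissa a b p q := by
    simp only [latticeAbscissa]; push_cast; ring
  have := hle (-p) q hpq.neg_left hq (by rw [e]; linarith)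
  rwa [e, show (2 / (1 - ρ) - 1) * (1 - ρ) = 1 + ρ by field_simp; ring] at this

theorem finite_setOf_den_le (s : ℝ) (N : ℕ) :
    {r : ℚ | 0 < (r : ℝ) - s ∧ (r : ℝ) - s ≤ 1 ∧ r.den ≤ N}.Finite := by
  set M : ℤ := ⌈(|s| + 1) * N⌉
  refine Set.Finite.of_finite_image (f := fun r : ℚ => (r.num, r.den))
    (((Set.finite_Icc (-M) M).prod (Set.finite_Icc 0 N)).subset ?_) ?_
  · rintro _ ⟨r, ⟨h1, h2, h3⟩, rfl⟩
    have hd : (0 : ℝ) < r.den := by exact_mod_cast r.pos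
    have hdN : (r.den : ℝ) ≤ N := by exact_mod_cast h3
    have hnum : (r.num : ℝ) = r * r.den := by exact_mod_cast (Rat.mul_den_eq_num r).symm
    have habs : |(r : ℝ)| ≤ |s| + 1 := by
      rw [abs_le]
      constructor <;> linarith [neg_abs_le s, le_abs_self s]
    have h4 : |(r.num : ℝ)| ≤ M := by
      rw [hnum, abs_mul, abs_of_pos hd]
      calc |(r : ℝ)| * r.den ≤ (|s| + 1) * N := by gcongr
        _ ≤ M := Int.le_ceil _
    have h5 : |r.num| ≤ M := by exact_mod_cast h4
    rw [abs_le] at h5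
    exact ⟨h5, Nat.zero_le _, h3⟩
  · intro r _ t _ h
    simp only [Prod.mk.injEq] at h
    exact Rat.ext h.1 h.2

theorem exists_upperApproximant_large {s v τ : ℝ} (hv : 0 ≤ v) (hτ : 0 < τ)
    (h : (upperApproximants s v).Infinite) (M : ℝ) :
    ∃ r ∈ upperApproximants s v, M ≤ (r.den : ℝ) ^ τ := by
  have htend := (tendsto_rpow_atTop hτ).comp (tendsto_natCast_atTop_atTop (R := ℝ))
  obtain ⟨N, hN⟩ := Filter.eventually_atTop.1 (htend.eventually_ge_atTop M)
  obtain ⟨r, hr, hrN⟩ := (h.sdiff (finite_setOf_den_le s N)).nonempty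
  refine ⟨r, hr, hN r.den ?_⟩
  by_contra! hcon
  refine hrN ⟨hr.1, hr.2.le.trans ?_, hcon.le⟩
  have hden : (1 : ℝ) ≤ r.den := by exact_mod_cast r.pos
  exact div_le_one_of_le₀ (Real.one_le_rpow hden hv) (by positivity)

/-! ### From power bounds to the upper limit -/

section

open Filter

theorem exponentRatio_coe (c x : ℝ) : exponentRatio c (x : EReal) = (((x - c) / x : ℝ) : EReal) := by
  rw [exponentRatio, if_neg (EReal.coe_ne_top x), ← EReal.coe_sub, ← EReal.coe_div]

theorem lt_of_exponentRatio_lt {c ρ : ℝ} {e : EReal} (he : 1 ≤ e) (hρ : ρ < 1)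
    (h : exponentRatio c e < ρ) : e < ((c / (1 - ρ) : ℝ) : EReal) := by
  induction e with
  | bot => exact absurd (le_bot_iff.1 he) (EReal.coe_ne_bot 1)
  | top =>
    rw [exponentRatio, if_pos rfl] at h
    have : (1 : ℝ) < ρ := by exact_mod_cast h
    linarith
  | coe x =>
    have hx : 1 ≤ x := by exact_mod_cast he
    rw [exponentRatio_coe, EReal.coe_lt_coe_iff, div_lt_iff₀ (by linarith)] at h
    rw [EReal.coe_lt_coe_iff, lt_div_iff₀ (by linarith)]
    linarith

theorem lt_of_lt_exponentRatio {c ρ : ℝ} {e : EReal} (hc : 0 < c) (he : 1 ≤ e)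
    (h : ρ < exponentRatio c e) : ρ < 1 ∧ ((c / (1 - ρ) : ℝ) : EReal) < e := by
  induction e with
  | bot => exact absurd (le_bot_iff.1 he) (EReal.coe_ne_bot 1)
  | top =>
    rw [exponentRatio, if_pos rfl] at h
    exact ⟨by exact_mod_cast h, EReal.coe_lt_top _⟩
  | coe x =>
    have hx : 1 ≤ x := by exact_mod_cast he
    rw [exponentRatio_coe, EReal.coe_lt_coe_iff, lt_div_iff₀ (by linarith)] at h
    have hρ : ρ < 1 := by
      by_contra! hcon
      nlinarith
    refine ⟨hρ, ?_⟩
    rw [EReal.coe_lt_coe_iff, div_lt_iff₀ (by linarith)]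
    linarith

theorem exponentRatio_one_nonneg {e : EReal} (he : 1 ≤ e) : 0 ≤ exponentRatio 1 e := by
  induction e with
  | bot => exact absurd (le_bot_iff.1 he) (EReal.coe_ne_bot 1)
  | top => rw [exponentRatio, if_pos rfl]; exact zero_le_one
  | coe x =>
    have hx : 1 ≤ x := by exact_mod_cast he
    rw [exponentRatio_coe]
    exact_mod_cast div_nonneg (by linarith) (by linarith)

theorem log_abs_intCast_nonneg (z : ℤ) : 0 ≤ Real.log |(z : ℝ)| := by
  rw [← Int.cast_abs]
  exact Real.log_intCast_nonneg _

/-- A nonzero integer has absolute value at least `1`, and `Real.log 0 = 0` covers the zeros of `f`.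
-/
theorem limsup_log_div_log_nonneg (f : ℕ → ℤ) :
    0 ≤ limsup (fun n : ℕ => ((Real.log |(f n : ℝ)| / Real.log n : ℝ) : EReal)) atTop := by
  refine le_limsup_of_frequently_le (Frequently.of_forall fun n => ?_)
  exact_mod_cast div_nonneg (log_abs_intCast_nonneg _) (Real.log_natCast_nonneg n)

theorem limsup_log_div_log_le {f : ℕ → ℤ} {C ρ : ℝ} (hρ : 0 ≤ ρ)
    (hf : ∀ n : ℕ, 1 ≤ n → |(f n : ℝ)| ≤ C * (n : ℝ) ^ ρ) :
    limsup (fun n : ℕ => ((Real.log |(f n : ℝ)| / Real.log n : ℝ) : EReal)) atTop ≤ ρ := by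
  have htend : Tendsto (fun n : ℕ => Real.log (max C 1) / Real.log n + ρ) atTop (nhds (0 + ρ)) :=
    (Tendsto.div_atTop tendsto_const_nhds
      (Real.tendsto_log_atTop.comp tendsto_natCast_atTop_atTop)).add_const ρ
  rw [zero_add] at htend
  have htend' := (continuous_coe_real_ereal.tendsto ρ).comp htend
  rw [← htend'.limsup_eq]
  refine limsup_le_limsup ?_
  filter_upwards [eventually_ge_atTop 2] with n hn
  have hn' : (2 : ℝ) ≤ n := by exact_mod_cast hn
  have hlog : 0 < Real.log n := Real.log_pos (by linarith)
  have hC : 0 ≤ Real.log (max C 1) := Real.log_nonneg (le_max_right _ _)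
  refine EReal.coe_le_coe_iff.2 ?_
  change _ ≤ Real.log (max C 1) / Real.log n + ρ
  rw [div_add' _ _ _ hlog.ne']
  gcongr
  rcases eq_or_ne (f n) 0 with h0 | h0
  · rw [h0]
    simp only [Int.cast_zero, abs_zero, Real.log_zero]
    positivity
  · have hpos : 0 < |(f n : ℝ)| := abs_pos.2 (by exact_mod_cast h0)
    have hn0 : (0 : ℝ) < n := by linarith
    have hC1 : (0 : ℝ) < max C 1 := lt_of_lt_of_le one_pos (le_max_right _ _)
    rw [← Real.log_rpow hn0, ← Real.log_mul hC1.ne' (by positivity)]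
    refine Real.log_le_log hpos ((hf n (by omega)).trans ?_)
    gcongr
    exact le_max_left _ _

theorem le_limsup_log_div_log {f : ℕ → ℤ} {c ρ : ℝ} (hc : 0 < c)
    (hf : ∀ M : ℝ, ∃ n : ℕ, M ≤ |(f n : ℝ)| ∧ c * (n : ℝ) ^ ρ ≤ |(f n : ℝ)|) :
    (ρ : EReal) ≤ limsup (fun n : ℕ => ((Real.log |(f n : ℝ)| / Real.log n : ℝ) : EReal)) atTop := by
  have hfreq : ∃ᶠ n : ℕ in atTop, c * (n : ℝ) ^ ρ ≤ |(f n : ℝ)| := by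
    rw [frequently_atTop]
    intro N
    -- A value above the sum of the first `N` absolute values can only occur at an index `n ≥ N`.
    obtain ⟨n, hn, hcn⟩ := hf (∑ i ∈ Finset.range N, |(f i : ℝ)| + 1)
    refine ⟨n, ?_, hcn⟩
    by_contra! hcon
    have := Finset.single_le_sum (f := fun i => |(f i : ℝ)|) (fun i _ => abs_nonneg _)
      (Finset.mem_range.2 hcon)
    linarith
  refine EReal.ge_of_forall_gt_iff_ge.1 fun z hz => ?_
  have hz' : z < ρ := EReal.coe_lt_coe_iff.1 hz
  refine le_limsup_of_frequently_le ?_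
  have htend : Tendsto (fun n : ℕ => Real.log n) atTop atTop :=
    Real.tendsto_log_atTop.comp tendsto_natCast_atTop_atTop
  refine (hfreq.and_eventually ((htend.eventually_ge_atTop (-Real.log c / (ρ - z))).and
    (eventually_ge_atTop 2))).mono ?_
  rintro n ⟨h1, h2, h3⟩
  have hn' : (2 : ℝ) ≤ n := by exact_mod_cast h3
  have hn0 : (0 : ℝ) < n := by linarith
  have hlog : 0 < Real.log n := Real.log_pos (by linarith)
  refine EReal.coe_le_coe_iff.2 ?_
  rw [le_div_iff₀ hlog]
  have h4 := Real.log_le_log (by positivity) h1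
  rw [Real.log_mul hc.ne' (by positivity), Real.log_rpow hn0] at h4
  rw [div_le_iff₀ (by linarith)] at h2
  linarith

namespace IsFareyChain

variable {a b : ℝ} {K p q : ℕ → ℤ}

/-- With `s` the denominator, `1 / x ≥ s ^ (ρ / (1 - ρ))` is equivalent to `(s / x) ^ ρ ≤ 1 / x`;
the index is at most `s / (a * x)` and the sum is about `1 / x`. -/
theorem exists_le_sum_of_upperApproximants_infinite (h : IsFareyChain a b K p q)
    (hsum : ∀ n, 1 < latticeAbscissa a b (p n) (q n) + latticeAbscissa a b (p (n + 1)) (q (n + 1)))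
    {ρ : ℝ} (hρ : 0 < ρ) (hρ1 : ρ < 1)
    (hinf : (upperApproximants (b / a) (1 / (1 - ρ))).Infinite) (M : ℝ) :
    ∃ n : ℕ, M ≤ |((∑ i ∈ Finset.range (n + 1), (K i - 3) : ℤ) : ℝ)| ∧
      a ^ ρ / 2 * (n : ℝ) ^ ρ ≤ |((∑ i ∈ Finset.range (n + 1), (K i - 3) : ℤ) : ℝ)| := by
  have ha := h.a_pos
  have hρ' : 0 < 1 - ρ := by linarith
  have hv : 1 / (1 - ρ) - 1 = ρ / (1 - ρ) := by field_simp; ring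
  have hτ : 0 < 1 / (1 - ρ) - 1 := by rw [hv]; positivity
  obtain ⟨r, hr, hlarge⟩ := exists_upperApproximant_large (by positivity) hτ hinf
    -- The `6` gives `1 / x - 3 ≥ 1 / x / 2`, and also `x ≤ 1`.
    (max 6 (2 * M))
  have hden : (1 : ℝ) ≤ r.den := by exact_mod_cast r.pos
  have hden0 : (0 : ℝ) < r.den := by linarith
  have e := latticeAbscissa_eq ha b r.num (q := r.den) (by exact_mod_cast r.pos)
  rw [Int.cast_natCast, Int.cast_natCast, Rat.num_div_den] at e
  have hx : 0 < latticeAbscissa a b r.num r.den := by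
    rw [e]; exact mul_pos (by positivity) hr.1
  have hy : (r.den : ℝ) ^ (1 / (1 - ρ) - 1) ≤ 1 / latticeAbscissa a b r.num r.den := by
    rw [le_div_iff₀ hx, e]
    have h1 := hr.2
    rw [lt_div_iff₀ (by positivity)] at h1
    calc (r.den : ℝ) ^ (1 / (1 - ρ) - 1) * (a * r.den * (r - b / a))
        = a * ((r - b / a) * ((r.den : ℝ) ^ (1 / (1 - ρ) - 1) * r.den)) := by ring
      _ = a * ((r - b / a) * (r.den : ℝ) ^ (1 / (1 - ρ))) := by
          rw [← Real.rpow_add_one hden0.ne', sub_add_cancel]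
      _ ≤ 1 * 1 := by
          gcongr
          · exact mul_nonneg hr.1.le (by positivity)
          · exact h.a_le_one
      _ = 1 := one_mul 1
  have hM1 := (le_max_left _ _).trans (hlarge.trans hy)
  have hM2 := (le_max_right _ _).trans (hlarge.trans hy)
  obtain ⟨n, hn1, hn2⟩ := h.exists_large_sum_of_upper hsum
    (Rat.isCoprime_num_den r) (by exact_mod_cast r.pos) hx (by
      rw [le_div_iff₀ hx] at hM1
      linarith)
  set x := latticeAbscissa a b r.num r.den
  refine ⟨n, by linarith, le_trans ?_ (by linarith : 1 / x / 2 ≤ _)⟩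
  have hy0 : 0 < 1 / x := by positivity
  have h1 : (r.den : ℝ) ^ ρ ≤ (1 / x) ^ (1 - ρ) := by
    have := Real.rpow_le_rpow (by positivity) hy hρ'.le
    rwa [← Real.rpow_mul hden0.le, hv, div_mul_cancel₀ _ hρ'.ne'] at this
  have h2 : (a * n) ^ ρ ≤ (r.den * (1 / x)) ^ ρ := by
    refine Real.rpow_le_rpow (by positivity) ?_ hρ.le
    rw [mul_one_div]
    exact_mod_cast hn2
  rw [Real.mul_rpow ha.le n.cast_nonneg, Real.mul_rpow hden0.le hy0.le] at h2
  have h3 : (r.den : ℝ) ^ ρ * (1 / x) ^ ρ ≤ 1 / x := by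
    calc (r.den : ℝ) ^ ρ * (1 / x) ^ ρ ≤ (1 / x) ^ (1 - ρ) * (1 / x) ^ ρ := by gcongr
      _ = 1 / x := by rw [← Real.rpow_add hy0, sub_add_cancel, Real.rpow_one]
  linarith

/-- With `s` the denominator, the sum is of order `Y = 1 / (ξ * s)` at an index at most `s / (a *
ξ)`, and `(s / ξ) ^ ρ ≤ Y` is equivalent to `s ^ (1 + ρ) ≤ (1 / ξ) ^ (1 - ρ)`. -/
theorem exists_le_sum_of_lowerApproximants_infinite (h : IsFareyChain a b K p q)
    (hsum : ∀ n, 1 < latticeAbscissa a b (p n) (q n) + latticeAbscissa a b (p (n + 1)) (q (n + 1)))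
    (hb : 0 < b) {ρ : ℝ} (hρ : 0 < ρ) (hρ1 : ρ < 1)
    (hinf : (upperApproximants (-b / a) (2 / (1 - ρ))).Infinite) (M : ℝ) :
    ∃ n : ℕ, M ≤ |((∑ i ∈ Finset.range (n + 1), (K i - 3) : ℤ) : ℝ)| ∧
      a * a ^ ρ / 8 * (n : ℝ) ^ ρ ≤ |((∑ i ∈ Finset.range (n + 1), (K i - 3) : ℤ) : ℝ)| := by
  have ha := h.a_pos
  have hρ' : 0 < 1 - ρ := by linarith
  have hv : 2 / (1 - ρ) - 1 = (1 + ρ) / (1 - ρ) := by field_simp; ring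
  have hv2 : 2 / (1 - ρ) - 2 = 2 * ρ / (1 - ρ) := by field_simp; ring
  have hτ : 0 < 2 / (1 - ρ) - 2 := by rw [hv2]; positivity
  obtain ⟨r, hr, hlarge⟩ := exists_upperApproximant_large (by positivity) hτ hinf
    -- From `Y * a ≥ 20` and `J > Y * a / 2 - 4` follows `(J - 1) / 2 ≥ Y * a / 8`.
    (max (20 / a) (8 * M / a))
  have hden : (1 : ℝ) ≤ r.den := by exact_mod_cast r.pos
  have hden0 : (0 : ℝ) < r.den := by linarith
  have e := latticeAbscissa_eq ha (-b) r.num (q := r.den) (by exact_mod_cast r.pos)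
  rw [Int.cast_natCast, Int.cast_natCast, Rat.num_div_den] at e
  have e' : latticeAbscissa a b (-r.num) r.den = -latticeAbscissa a (-b) r.num r.den := by
    simp only [latticeAbscissa]; push_cast; ring
  have hξ : 0 < latticeAbscissa a (-b) r.num r.den := by
    rw [e]; exact mul_pos (by positivity) hr.1
  have hy : (r.den : ℝ) ^ (2 / (1 - ρ) - 1) ≤ 1 / latticeAbscissa a (-b) r.num r.den := by
    rw [le_div_iff₀ hξ, e]
    have h1 := hr.2
    rw [lt_div_iff₀ (by positivity)] at h1
    calc (r.den : ℝ) ^ (2 / (1 - ρ) - 1) * (a * r.den * (r - -b / a))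
        = a * ((r - -b / a) * ((r.den : ℝ) ^ (2 / (1 - ρ) - 1) * r.den)) := by ring
      _ = a * ((r - -b / a) * (r.den : ℝ) ^ (2 / (1 - ρ))) := by
          rw [← Real.rpow_add_one hden0.ne', sub_add_cancel]
      _ ≤ 1 * 1 := by
          gcongr
          · exact mul_nonneg hr.1.le (by positivity)
          · exact h.a_le_one
      _ = 1 := one_mul 1
  have hlow := fun J : ℕ => h.exists_large_sum_of_lower hsum hb (r := -r.num) (s := r.den)
    (Rat.isCoprime_num_den r).neg_left (by exact_mod_cast r.pos) (by rw [e']; linarith) (J := J)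
  simp only [e', neg_neg] at hlow
  set ξ := latticeAbscissa a (-b) r.num r.den
  have hy0 : 0 < 1 / ξ := by positivity
  obtain ⟨Y, hY⟩ : ∃ Y, Y = 1 / ξ / r.den := ⟨_, rfl⟩
  have hYden : Y * r.den = 1 / ξ := by rw [hY]; field_simp
  have hYlarge : (r.den : ℝ) ^ (2 / (1 - ρ) - 2) ≤ Y := by
    rw [hY, le_div_iff₀ hden0, ← Real.rpow_add_one hden0.ne',
      show 2 / (1 - ρ) - 2 + 1 = 2 / (1 - ρ) - 1 by ring]
    exact hy
  have hY1 := (le_max_left _ _).trans (hlarge.trans hYlarge)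
  have hY2 := (le_max_right _ _).trans (hlarge.trans hYlarge)
  rw [div_le_iff₀ ha] at hY1 hY2
  set J := ⌊Y * a / 2 - 3⌋₊
  have hJ1 : (J : ℝ) ≤ Y * a / 2 - 3 := Nat.floor_le (by linarith)
  have hJ2 : Y * a / 2 - 3 < J + 1 := Nat.lt_floor_add_one _
  obtain ⟨n, hn1, hn2⟩ := hlow J (by
    push_cast
    have hYξ : ξ * r.den * Y = 1 := by rw [hY]; field_simp
    calc 2 * ξ * ((J + 3) * r.den) = 2 * (ξ * r.den) * (J + 3) := by ring
      _ ≤ 2 * (ξ * r.den) * (Y * a / 2) := by gcongr; linarith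
      _ = a * (ξ * r.den * Y) := by ring
      _ ≤ a := by rw [hYξ, mul_one])
  refine ⟨n, by linarith, le_trans ?_ (by linarith : Y * a / 8 ≤ _)⟩
  have h1 : (r.den : ℝ) ^ (1 + ρ) ≤ (1 / ξ) ^ (1 - ρ) := by
    have := Real.rpow_le_rpow (by positivity) hy hρ'.le
    rwa [← Real.rpow_mul hden0.le, hv, div_mul_cancel₀ _ hρ'.ne'] at this
  have h2 : (a * n) ^ ρ ≤ (r.den * (1 / ξ)) ^ ρ := by
    refine Real.rpow_le_rpow (by positivity) ?_ hρ.le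
    rw [mul_one_div, le_div_iff₀ hξ]
    push_cast at hn2
    linarith
  rw [Real.mul_rpow ha.le n.cast_nonneg, Real.mul_rpow hden0.le hy0.le] at h2
  have h3 : (r.den : ℝ) ^ ρ * (1 / ξ) ^ ρ ≤ Y := by
    rw [hY, le_div_iff₀ hden0]
    calc (r.den : ℝ) ^ ρ * (1 / ξ) ^ ρ * r.den = (r.den : ℝ) ^ (1 + ρ) * (1 / ξ) ^ ρ := by
          rw [Real.rpow_add hden0, Real.rpow_one]; ring
      _ ≤ (1 / ξ) ^ (1 - ρ) * (1 / ξ) ^ ρ := by gcongr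
      _ = 1 / ξ := by rw [← Real.rpow_add hy0, sub_add_cancel, Real.rpow_one]
  have h4 := mul_le_mul_of_nonneg_left (h2.trans h3) ha.le
  linarith

end IsFareyChain

end

theorem theorem1p3 (a b : ℝ) (hab : (a, b) ∈ fareyTriangle) (hirr : Irrational (b / a)) :
    Filter.limsup
        (fun n : ℕ =>
          ((Real.log |(backwardSum ⟨(a, b), hab⟩ n : ℝ)| / Real.log (n : ℝ) : ℝ) : EReal))
        Filter.atTop
      = max (exponentRatio 1 (evenDiophantineExponent (b / a)))
          (exponentRatio 2 (oddDiophantineExponent (b / a))) := by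
  obtain ⟨K, p, q, h, hsum, hf⟩ := exists_isFareyChain_itinerary hab
  have ha : 0 < a := hab.1.1
  have hb : 0 < b := hab.2.1.1
  have heven := one_le_evenDiophantineExponent hirr
  have hodd : 1 ≤ oddDiophantineExponent (b / a) := by
    rw [oddDiophantineExponent_eq]
    exact one_le_evenDiophantineExponent hirr.neg
  simp only [hf]
  apply le_antisymm
  · refine EReal.le_of_forall_lt_iff_le.1 fun ρ hρ => ?_
    obtain ⟨hρe, hρo⟩ := max_lt_iff.1 hρ
    have hρ0 : 0 < ρ := by
      exact_mod_cast (exponentRatio_one_nonneg heven).trans_lt hρe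
    rcases lt_or_ge ρ 1 with hρ1 | hρ1
    · obtain ⟨C, -, hC⟩ := h.abs_sum_le_rpow hsum hb hirr hρ0 hρ1.le
        (upperApproxBound_of_lt ha h.a_le_one hρ1 (lt_of_exponentRatio_lt heven hρ1 hρe))
        (lowerApproxBound_of_lt ha h.a_le_one hρ1 (lt_of_exponentRatio_lt hodd hρ1 hρo))
      exact limsup_log_div_log_le hρ0.le hC
    -- For `ρ ≥ 1` the linear bound suffices; its approximation hypotheses hold for every slope.
    · obtain ⟨C, -, hC⟩ := h.abs_sum_le_rpow hsum hb hirr one_pos le_rfl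
        (upperApproxBound_one a b) (lowerApproxBound_one a b)
      exact (limsup_log_div_log_le zero_le_one hC).trans (by exact_mod_cast hρ1)
  · refine EReal.ge_of_forall_gt_iff_ge.1 fun ρ hρ => ?_
    rcases le_or_gt ρ 0 with hρ0 | hρ0
    · exact le_trans (by exact_mod_cast hρ0) (limsup_log_div_log_nonneg _)
    rcases lt_max_iff.1 hρ with hρe | hρo
    · obtain ⟨hρ1, hv⟩ := lt_of_lt_exponentRatio one_pos heven hρe
      exact le_limsup_log_div_log (by positivity)
        (h.exists_le_sum_of_upperApproximants_infinite hsum hρ0 hρ1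
          (upperApproximants_infinite_of_lt hv))
    · obtain ⟨hρ1, hv⟩ := lt_of_lt_exponentRatio two_pos hodd hρo
      rw [oddDiophantineExponent_eq, ← neg_div] at hv
      exact le_limsup_log_div_log (by positivity)
        (h.exists_le_sum_of_lowerApproximants_infinite hsum hb hρ0 hρ1
          (upperApproximants_infinite_of_lt hv))
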